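/- Let $p\ne s$ be primes, $K$ a finite extension of $\mathbb Q_p$ with its absolute value $|\cdot|$ extending that of $\mathbb Q_p$, $K_s$ a complete non-Archimedean valued extension of $\mathbb Q_s$ (for instance a local field), and $F\supseteq K_s$ a complete non-Archimedean valued field. Fix a nontrivial continuous character $\chi$ of the additive group of $K$ whose values are roots of unity in $F$, and real powers of $s$ in $F$, i.e. a homomorphism $a\mapsto s^a$ from $(\mathbb R,+)$ to $F^\times$ with $s^1=s$ (every such choice is allowed; in particular one with $|s^a|=s^{-a}$). Let $q>0$. Let $X=\varprojlim_j c_0(\alpha_j,K)$ and $Y=\varprojlim_j \ell_2(\alpha_j,\mathbb R)$ be projective limits, over the same (pre)ordered set, with continuous linear connecting maps, and let $\varphi_j:X\to c_0(\alpha_j,K)$ and $\psi_j:Y\to\ell_2(\alpha_j,\mathbb R)$ be the projections. For a continuous $K$-linear functional $z_j$ on $c_0(\alpha_j,K)$ with coordinates $z_{k,j}=z_j(e_k)$ put $v_q^s(z_j)=(s^{-q\,\mathrm{ord}_p(z_{k,j})/2})_{k\in\alpha_j}$ (real numbers, with $|x|=p^{-\mathrm{ord}_p(x)}$, and the entry $0$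 where $z_{k,j}=0$). If it lies in $\ell_2(\alpha_j,\mathbb R)$, regard it as the element $y\mapsto\langle v_q^s(z_j),\psi_j(y)\rangle$ of $Y^*$. Let $D$ be the set of the functionals $z=z_j\circ\varphi_j$ on $X$ with $v_q^s(z_j)\in\ell_2(\alpha_j,\mathbb R)$. A measure on $X$ is a function $\mu$ from the ring of clopen subsets of $X$ to $K_s$ that is additive, bounded, and tends to $0$ along every shrinking family of clopen sets with empty intersection; integrals are limits of integrals of step functions in the seminorm $\sup_x|f(x)|N_\mu(x)$, where $N_\mu(x)=\inf_{A\ni x}\sup_{C\subseteq A}|\mu(C)|$ with $A,C$ clopen. Let $\gamma\in X$ and let $B$ be a symmetric nonnegative definite bilinear form on $Y^*$. The measure $\mu$ is a $q$-Gaussian measure $\mu_{q,B,\gamma}$ if $D$ is a $K$-linear subspace of $X^*$ and $$\int_X\chi(z(x))\,\mu(dx)=s^{B(v_q^s(z_j),\,v_q^s(z_j))}\,\chi(z(\gamma))$$ for all $j$ and all $z=z_j\circ\varphi_j$ with $v_q^s(z_j)\in\ell_2(\alpha_j,\mathbb R)$. The form $B$ is of class $L_1$ if on each $\ell_2(\alpha_j,\mathbb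 R)$ it is given by a bounded operator $T_j$, $B(u,w)=\langle T_ju,w\rangle$, with $\sum_k\langle T_je_k,e_k\rangle<\infty$. Let $\mu_{q,B,\gamma}$ and $\mu_{q,E,\delta}$ be $q$-Gaussian measures on $X$ with $B$ and $E$ of class $L_1$. Then $B+E$ is of class $L_1$, and there exists a (unique) convolution $\mu_{q,B,\gamma}*\mu_{q,E,\delta}$, that is, a measure $\rho$ on $X$ with $\rho(A)=\int_X\mu_{q,B,\gamma}(A-x)\,\mu_{q,E,\delta}(dx)$ for every clopen $A\subseteq X$. It is a $q$-Gaussian measure $\mu_{q,B+E,\gamma+\delta}$, and every $q$-Gaussian measure $\mu_{q,B+E,\gamma+\delta}$ on $X$ is equal to it. -/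

import Mathlib

open scoped ZeroAtInfty

noncomputable section

namespace QGauss

/-! ### Measures with values in a non-Archimedean field, and their integrals -/

/-- A measure with values in a (non-Archimedean) normed field `L` on the ring `Bco(X)` of all clopen
subsets of `X`: additive, bounded, and tending to zero along every shrinking family of clopen sets
with empty intersection. -/
@[ext]
structure TightMeasure (X : Type*) [TopologicalSpace X] (L : Type*) [NormedField L] where
  toFun : TopologicalSpace.Clopens X → L
  additive : ∀ A C, Disjoint A C → toFun (A ⊔ C) = toFun A + toFun C
  bounded : ∃ c : ℝ, ∀ A, ‖toFun A‖ ≤ c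
  shrinking : ∀ S : Set (TopologicalSpace.Clopens X), S.Nonempty →
    (∀ A ∈ S, ∀ C ∈ S, ∃ D ∈ S, D ≤ A ⊓ C) → (⋂ A ∈ S, (A : Set X)) = ∅ →
    ∀ ε > 0, ∃ A₀ ∈ S, ∀ A ∈ S, A ≤ A₀ → ‖toFun A‖ ≤ ε

section Measure

variable {X : Type*} [TopologicalSpace X] {L : Type*} [NormedField L]

/-- `‖A‖_μ`, the supremum of `|μ(C)|` over the clopen `C ⊆ A`. -/
def TightMeasure.normOn (μ : TightMeasure X L) (A : TopologicalSpace.Clopens X) : ℝ :=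
  ⨆ C : {C : TopologicalSpace.Clopens X // C ≤ A}, ‖μ.toFun C.1‖

/-- `N_μ(x)`, the infimum of `‖A‖_μ` over the clopen `A` that contain `x`. -/
def TightMeasure.density (μ : TightMeasure X L) (x : X) : ℝ :=
  ⨅ A : {A : TopologicalSpace.Clopens X // x ∈ A}, μ.normOn A.1

/-- The function `f : X → F` is integrable with respect to the `L`-valued measure `μ`, and its
integral is `I`: in the seminorm `sup_x |f(x)| N_μ(x)` the function `f` is a limit of step functions
`∑ cᵢ 1_{Aᵢ}` whose integrals `∑ cᵢ μ(Aᵢ)` tend to `I`. -/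
def TightMeasure.HasIntegral {F : Type*} [NormedField F] [NormedAlgebra L F]
    (μ : TightMeasure X L) (f : X → F) (I : F) : Prop :=
  ∀ ε > 0, ∃ (n : ℕ) (c : Fin n → F) (A : Fin n → TopologicalSpace.Clopens X),
    (∀ x, ‖f x - ∑ i, (A i : Set X).indicator (fun _ => c i) x‖ * μ.density x ≤ ε) ∧
    ‖I - ∑ i, c i * algebraMap L F (μ.toFun (A i))‖ ≤ ε

/-- The clopen set `A - x`. -/
def translate [AddGroup X] [IsTopologicalAddGroup X] (A : TopologicalSpace.Clopens X) (x : X) :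
    TopologicalSpace.Clopens X :=
  ⟨(fun y => y + x) ⁻¹' (A : Set X), A.isClopen.preimage (by fun_prop)⟩

/-- `ρ` is the convolution of `μ` and `ν`: for every clopen `A` the function `x ↦ μ(A - x)` is
`ν`-integrable and its integral is `ρ(A)`. -/
def IsConvolution [AddGroup X] [IsTopologicalAddGroup X] (μ ν ρ : TightMeasure X L) : Prop :=
  ∀ A, ν.HasIntegral (fun x => μ.toFun (translate A x)) (ρ.toFun A)

end Measure

/-! ### The spaces -/

/-- The real Hilbert space `l₂(α, ℝ)`. -/
abbrev Ell2 (α : Type*) := lp (fun _ : α => ℝ) 2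

/-- The vector `e_k` of the standard basis of `l₂(α, ℝ)`. -/
def ell2Basis {α : Type*} (k : α) : Ell2 α := by
  classical exact lp.single 2 k (1 : ℝ)

/-- The vector `e_k` of the standard basis of `c₀(α, K)`. -/
def basisVec {K : Type*} [NormedField K] {α : Type*} [TopologicalSpace α] [DiscreteTopology α]
    (k : α) : C₀(α, K) where
  toFun := by classical exact fun m => if m = k then 1 else 0
  continuous_toFun := continuous_of_discreteTopology
  zero_at_infty' := by
    classical
    rw [Filter.cocompact_eq_cofinite]
    refine tendsto_const_nhds.congr' ?_
    have h : {m : α | m ≠ k} ∈ Filter.cofinite := by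
      simp [Filter.mem_cofinite, Set.compl_ofPred]
    filter_upwards [h] with m hm
    exact (if_neg hm).symm

/-- Two projective systems over the same (pre)ordered set: one of the Banach spaces `c₀(α_j, K)`
(`α_j` carries the discrete topology), the other of the Hilbert spaces `l₂(α_j, ℝ)`. -/
structure ProjSystems (K : Type*) [NontriviallyNormedField K] {Υ : Type*} [Preorder Υ]
    (α : Υ → Type*) [∀ j, TopologicalSpace (α j)] where
  φ : ∀ {l j : Υ}, l ≤ j → C₀(α j, K) →L[K] C₀(α l, K)
  φ_refl : ∀ (j : Υ) (x : C₀(α j, K)), φ (le_refl j) x = x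
  φ_comp : ∀ {k l j : Υ} (hkl : k ≤ l) (hlj : l ≤ j) (x : C₀(α j, K)),
    φ hkl (φ hlj x) = φ (hkl.trans hlj) x
  ψ : ∀ {l j : Υ}, l ≤ j → Ell2 (α j) →L[ℝ] Ell2 (α l)
  ψ_refl : ∀ (j : Υ) (y : Ell2 (α j)), ψ (le_refl j) y = y
  ψ_comp : ∀ {k l j : Υ} (hkl : k ≤ l) (hlj : l ≤ j) (y : Ell2 (α j)),
    ψ hkl (ψ hlj y) = ψ (hkl.trans hlj) y

namespace ProjSystems

variable {K : Type*} [NontriviallyNormedField K] {Υ : Type*} [Preorder Υ]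
  {α : Υ → Type*} [∀ j, TopologicalSpace (α j)] (S : ProjSystems K α)

/-- The projective limit `X` of the spaces `c₀(α_j, K)`, with the topology of the product. -/
def X : Submodule K (∀ j, C₀(α j, K)) where
  carrier := {x | ∀ (l j : Υ) (h : l ≤ j), S.φ h (x j) = x l}
  add_mem' := fun hx hy l j h => by simp [hx l j h, hy l j h]
  zero_mem' := fun l j h => by simp
  smul_mem' := fun c x hx l j h => by simp [hx l j h]

/-- The projective limit `Y` of the spaces `l₂(α_j, ℝ)`, with the topology of the product. -/
def Y : Submodule ℝ (∀ j, Ell2 (α j)) where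
  carrier := {y | ∀ (l j : Υ) (h : l ≤ j), S.ψ h (y j) = y l}
  add_mem' := fun hx hy l j h => by simp [hx l j h, hy l j h]
  zero_mem' := fun l j h => by simp
  smul_mem' := fun c x hx l j h => by simp [hx l j h]

/-- The projection `φ_j : X → c₀(α_j, K)`. -/
def projX (j : Υ) : S.X →L[K] C₀(α j, K) :=
  (ContinuousLinearMap.proj j).comp S.X.subtypeL

/-- The projection `ψ_j : Y → l₂(α_j, ℝ)`. -/
def projY (j : Υ) : S.Y →L[ℝ] Ell2 (α j) :=
  (ContinuousLinearMap.proj j).comp S.Y.subtypeL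

/-- A vector `u` of `l₂(α_j, ℝ) = l₂(α_j, ℝ)*` as the element `y ↦ ⟨u, ψ_j(y)⟩` of `Y*`. -/
def toDual (j : Υ) (u : Ell2 (α j)) : S.Y →L[ℝ] ℝ :=
  (innerSL ℝ u).comp (S.projY j)

/-- The bilinear functional `B` on `Y*` is of class `L₁`: on each `l₂(α_j, ℝ)` it is given by a
bounded correlation operator `T`, `B(u, w) = ⟨T u, w⟩`, of finite trace. (For the symmetric
nonnegative `B` below, `T` is a positive operator, and this is the usual trace class.) -/
def IsTraceClass (B : LinearMap.BilinForm ℝ (S.Y →L[ℝ] ℝ)) : Prop :=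
  ∀ j, ∃ T : Ell2 (α j) →L[ℝ] Ell2 (α j),
    (∀ u w, B (S.toDual j u) (S.toDual j w) = inner ℝ (T u) w) ∧
    Summable fun k : α j => (inner ℝ (T (ell2Basis k)) (ell2Basis k) : ℝ)

end ProjSystems

/-! ### `q`-Gaussian measures -/

/-- `ord_p(x)`, that is, `|x| = p ^ (-ord_p(x))` (for `x ≠ 0`). -/
def ordP {K : Type*} [NormedField K] (p : ℕ) (x : K) : ℝ := -Real.logb p ‖x‖

/-- The real number `|s ^ (q ord_p(x) / 2)|_s = s ^ (-q ord_p(x) / 2)`, which is `0` for `x = 0`. -/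
def vCoord {K : Type*} [NormedField K] (p s : ℕ) (q : ℝ) (x : K) : ℝ := by
  classical exact if x = 0 then 0 else (s : ℝ) ^ (-(q * ordP p x / 2))

section Gaussian

variable {K : Type*} [NontriviallyNormedField K] {Υ : Type*} [Preorder Υ]
  {α : Υ → Type*} [∀ j, TopologicalSpace (α j)] [∀ j, DiscreteTopology (α j)]

/-- The family `v_q^s(z)` of a continuous functional `z` on `c₀(α, K)`, whose coordinates are
`z_k = z(e_k)`. -/
def vFun {β : Type*} [TopologicalSpace β] [DiscreteTopology β] (p s : ℕ) (q : ℝ)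
    (z : C₀(β, K) →L[K] K) : β → ℝ :=
  fun k => vCoord p s q (z (basisVec k))

/-- The continuous functionals on `X` of the form `z_j ∘ φ_j` with `v_q^s(z_j)` in `l₂(α_j, ℝ)`. -/
def domain (S : ProjSystems K α) (p s : ℕ) (q : ℝ) : Set (S.X →L[K] K) :=
  {z | ∃ (j : Υ) (zj : C₀(α j, K) →L[K] K), Memℓp (vFun p s q zj) 2 ∧ z = zj.comp (S.projX j)}

/-- `μ` is a `q`-Gaussian measure `μ_{q,B,γ}`: `B` is symmetric and nonnegative definite, the
functionals above form a `K`-linear subspace, and on it the characteristic functional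
`∫ χ(z(x)) μ(dx)` is `s ^ B(v_q^s(z), v_q^s(z)) χ(z(γ))`. Here `χ` is the fixed character of `K` and
`spow a` is the power `s ^ a` in `F`. -/
structure IsQGaussian (S : ProjSystems K α) {L F : Type*} [NormedField L] [NormedField F]
    [NormedAlgebra L F] (p s : ℕ) (χ : AddChar K F) (spow : Multiplicative ℝ →* F) (q : ℝ)
    (B : LinearMap.BilinForm ℝ (S.Y →L[ℝ] ℝ)) (γ : S.X) (μ : TightMeasure S.X L) : Prop where
  symm : ∀ u w, B u w = B w u
  nonneg : ∀ u, 0 ≤ B u u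
  linear : ∃ W : Submodule K (S.X →L[K] K), (W : Set (S.X →L[K] K)) = domain S p s q
  charFun : ∀ (j : Υ) (zj : C₀(α j, K) →L[K] K) (hv : Memℓp (vFun p s q zj) 2),
    μ.HasIntegral (fun x => χ (zj (S.projX j x)))
      (spow (Multiplicative.ofAdd (B (S.toDual j ⟨_, hv⟩) (S.toDual j ⟨_, hv⟩))) *
        χ (zj (S.projX j γ)))

end Gaussian

end QGauss

end

/-!
The measures involved are concentrated, up to sets of small norm, on small parts of the space: by
`TightMeasure.exists_normOn_le` the shrinking condition for the values `μ(A)` implies the one for the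
norms `‖A‖_μ`, so that finitely many members of any clopen cover exhaust the space up to a set of
small norm (`TightMeasure.exists_finset_normOn_compl_le`). Hence the integral of a step function is
bounded by its seminorm, integrals are unique, and bounded functions that are locally almost constant
are integrable (`TightMeasure.exists_hasIntegral`).

**Convolution.** The points whose coset modulo a small open subgroup `U` meets both `A` and its
complement form a clopen set which shrinks to the empty set with `U`. This makes `x ↦ μ(A - x)`
continuous, and its integrals with respect to `ν` are a measure
(`TightMeasure.exists_isConvolution`). A continuous character `χ` whose values are roots of unity has
values of `p`-power order, because `p ^ n x → 0`; as `p` is a unit in the residue field of `F`, such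
roots of unity are pairwise incongruent, and `χ` is locally constant (`isTame_of_continuous`). It
is therefore a step function on each window `{x | |z(x)| ≤ n + 1}`, and truncation to windows yields
the product formula for characteristic functionals (`IsConvolution.hasIntegral_char`). For
`q`-Gaussian measures the product of the two characteristic functionals is the one with parameters
`B + E` and `γ + δ`.

**Uniqueness.** On a window of `z`, the average of `χ(t z(x - a))` over `0 ≤ t < p ^ m` is the
indicator of a coset of the kernel of `χ ∘ z`, for large `m`; it is bounded by `1` everywhere, since
`p` is a unit in `F`. Therefore two measures with the same characteristic functional on a linear space
of functionals agree on finite intersections of such cosets (`agree_inf_charCoset`), then on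
arbitrary clopen intersections, on finite unions of these, and finally on all clopen sets
(`eq_of_agree_char`), provided that kernels of families of characters form a neighbourhood base of
zero. On a projective limit of spaces `c₀(α, K)` the multiples of the coordinates suffice for this
(`exists_charKer_subset`); they have finitely many nonzero coordinates and so belong to the domain of
every `q`-Gaussian measure.
-/

open TopologicalSpace Filter Topology

noncomputable section

namespace QGauss

/-! ### Small sets and the norm of a measure -/

namespace TightMeasure

variable {X : Type*} [TopologicalSpace X] {L : Type*} [NormedField L]

section Basic

variable (μ : TightMeasure X L)

lemma toFun_bot : μ.toFun ⊥ = 0 := by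
  have := μ.additive ⊥ ⊥ disjoint_bot_left
  simpa using this

lemma toFun_inf_add_sdiff (A C : Clopens X) :
    μ.toFun (A ⊓ C) + μ.toFun (A \ C) = μ.toFun A := by
  rw [← μ.additive _ _ disjoint_inf_sdiff, sup_inf_sdiff]

lemma bddAbove_norm (A : Clopens X) :
    BddAbove (Set.range fun C : {C : Clopens X // C ≤ A} => ‖μ.toFun C.1‖) := by
  obtain ⟨c, hc⟩ := μ.bounded
  exact ⟨c, by rintro _ ⟨C, rfl⟩; exact hc _⟩

lemma norm_le_normOn {A C : Clopens X} (h : C ≤ A) : ‖μ.toFun C‖ ≤ μ.normOn A :=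
  le_ciSup (μ.bddAbove_norm A) (⟨C, h⟩ : {C : Clopens X // C ≤ A})

lemma normOn_le {A : Clopens X} {ε : ℝ} (h : ∀ C ≤ A, ‖μ.toFun C‖ ≤ ε) : μ.normOn A ≤ ε := by
  have : Nonempty {C : Clopens X // C ≤ A} := ⟨⟨⊥, bot_le⟩⟩
  exact ciSup_le fun C => h C.1 C.2

lemma normOn_nonneg (A : Clopens X) : 0 ≤ μ.normOn A :=
  (norm_nonneg _).trans (μ.norm_le_normOn (le_refl A))

lemma normOn_mono {A C : Clopens X} (h : C ≤ A) : μ.normOn C ≤ μ.normOn A :=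
  μ.normOn_le fun _ hD => μ.norm_le_normOn (hD.trans h)

lemma density_le {A : Clopens X} {x : X} (hx : x ∈ A) : μ.density x ≤ μ.normOn A :=
  ciInf_le ⟨0, by rintro _ ⟨C, rfl⟩; exact μ.normOn_nonneg _⟩
    (⟨A, hx⟩ : {A : Clopens X // x ∈ A})

lemma density_nonneg (x : X) : 0 ≤ μ.density x :=
  Real.iInf_nonneg fun _ => μ.normOn_nonneg _

lemma exists_normOn_lt {x : X} {ε : ℝ} (h : μ.density x < ε) :
    ∃ A : Clopens X, x ∈ A ∧ μ.normOn A < ε := by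
  have : Nonempty {A : Clopens X // x ∈ A} := ⟨⟨⊤, Set.mem_univ x⟩⟩
  obtain ⟨A, hA⟩ := exists_lt_of_ciInf_lt h
  exact ⟨A.1, A.2, hA⟩

/-- A bound for all values of the measure, and hence for its density. -/
lemma exists_bound : ∃ c : ℝ, 1 ≤ c ∧ (∀ A, μ.normOn A ≤ c) ∧ ∀ x, μ.density x ≤ c := by
  obtain ⟨c, hc⟩ := μ.bounded
  have h : ∀ A, μ.normOn A ≤ max 1 c :=
    fun A => μ.normOn_le fun C _ => (hc C).trans (le_max_right _ _)
  exact ⟨max 1 c, le_max_left _ _, h, fun x =>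
    (μ.density_le (A := ⊤) (Set.mem_univ x)).trans (h _)⟩

variable [IsUltrametricDist L]

/-- The shrinking condition passes from the values `μ(A)` to the norms `‖A‖_μ`: it holds for the
family of the clopen sets that contain a member of the given one, and for `C ⊆ A i` one has
`μ(C) = μ(C ∪ A k) - μ(A k \ C)`. -/
lemma exists_normOn_le {ι : Type*} [Nonempty ι] (A : ι → Clopens X)
    (hdir : ∀ i j, ∃ k, A k ≤ A i ⊓ A j) (hempty : ∀ x, ∃ i, x ∉ A i) {ε : ℝ} (hε : 0 < ε) :
    ∃ i, μ.normOn (A i) ≤ ε := by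
  obtain ⟨i₀⟩ := ‹Nonempty ι›
  obtain ⟨C₀, ⟨i, hi⟩, h⟩ := μ.shrinking {C | ∃ i, A i ≤ C} ⟨A i₀, i₀, le_rfl⟩
    (by
      rintro C ⟨i, hi⟩ D ⟨j, hj⟩
      obtain ⟨k, hk⟩ := hdir i j
      exact ⟨A k, ⟨k, le_rfl⟩, hk.trans (inf_le_inf hi hj)⟩)
    (by
      refine Set.eq_empty_iff_forall_notMem.2 fun x hx => ?_
      obtain ⟨i, hi⟩ := hempty x
      exact hi (Set.mem_iInter₂.1 hx (A i) ⟨i, le_rfl⟩)) ε hε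
  refine ⟨i, μ.normOn_le fun D hD => ?_⟩
  obtain ⟨_, ⟨j, rfl⟩, h'⟩ := μ.shrinking (Set.range fun j => A j \ D) ⟨_, i₀, rfl⟩
    (by
      rintro _ ⟨i, rfl⟩ _ ⟨j, rfl⟩
      obtain ⟨k, hk⟩ := hdir i j
      exact ⟨_, ⟨k, rfl⟩, le_inf (sdiff_le_sdiff_right (hk.trans inf_le_left))
        (sdiff_le_sdiff_right (hk.trans inf_le_right))⟩)
    (by
      refine Set.eq_empty_iff_forall_notMem.2 fun x hx => ?_
      obtain ⟨i, hi⟩ := hempty x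
      exact hi (Set.mem_iInter₂.1 hx (A i \ D) ⟨i, rfl⟩).1) ε hε
  obtain ⟨k, hk⟩ := hdir i j
  have h1 := h (D ⊔ A k) ⟨k, le_sup_right⟩
    (sup_le (hD.trans hi) ((hk.trans inf_le_left).trans hi))
  have h2 := h' (A k \ D) ⟨k, rfl⟩ (sdiff_le_sdiff_right (hk.trans inf_le_right))
  have h3 : μ.toFun D = μ.toFun (D ⊔ A k) - μ.toFun (A k \ D) := by
    rw [← sup_sdiff_self_right D (A k), μ.additive _ _ disjoint_sdiff_self_right, add_sub_cancel_right]
  rw [h3, sub_eq_add_neg]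
  exact (IsUltrametricDist.norm_add_le_max _ _).trans (max_le h1 (by rwa [norm_neg]))

/-- Finitely many members of a clopen cover exhaust `X` up to a set of small norm. -/
lemma exists_finset_normOn_compl_le (V : X → Clopens X) (hV : ∀ x, x ∈ V x) {ε : ℝ} (hε : 0 < ε) :
    ∃ t : Finset X, μ.normOn (t.sup V)ᶜ ≤ ε := by
  classical
  refine μ.exists_normOn_le (fun t : Finset X => (t.sup V)ᶜ) (fun t u => ⟨t ∪ u, ?_⟩)
    (fun x => ⟨{x}, fun hx => hx ?_⟩) hε
  · simp [Finset.sup_union]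
  · simpa using hV x

lemma norm_sup_le {A C : Clopens X} : μ.normOn (A ⊔ C) ≤ max (μ.normOn A) (μ.normOn C) := by
  refine μ.normOn_le fun D hD => ?_
  rw [← μ.toFun_inf_add_sdiff D A]
  refine (IsUltrametricDist.norm_add_le_max _ _).trans (max_le_max ?_ ?_)
  · exact μ.norm_le_normOn inf_le_right
  · exact μ.norm_le_normOn (sdiff_le_iff.2 hD)

lemma le_sup_of_mem_iff {A C E : Clopens X} (h : ∀ y ∉ E, (y ∈ A ↔ y ∈ C)) : A ≤ C ⊔ E := by
  intro y hy
  by_cases hyE : y ∈ E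
  · exact Or.inr hyE
  · exact Or.inl ((h y hyE).1 hy)

lemma norm_sub_le_of_mem_iff {A C E : Clopens X} (h : ∀ y ∉ E, (y ∈ A ↔ y ∈ C)) :
    ‖μ.toFun A - μ.toFun C‖ ≤ μ.normOn E := by
  rw [← μ.toFun_inf_add_sdiff A C, ← μ.toFun_inf_add_sdiff C A, inf_comm C A,
    add_sub_add_left_eq_sub, sub_eq_add_neg]
  refine (IsUltrametricDist.norm_add_le_max _ _).trans (max_le ?_ ?_)
  · exact μ.norm_le_normOn (sdiff_le_iff.2 (le_sup_of_mem_iff h))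
  · rw [norm_neg]
    exact μ.norm_le_normOn (sdiff_le_iff.2 (le_sup_of_mem_iff fun y hy => (h y hy).symm))

end Basic

/-! ### Integrals -/

section Integral

variable {F : Type*} [NormedField F] [NormedAlgebra L F]
variable {μ : TightMeasure X L}

lemma add_mul_density_le [IsUltrametricDist F] {a b : F} {x : X} {ε : ℝ}
    (ha : ‖a‖ * μ.density x ≤ ε) (hb : ‖b‖ * μ.density x ≤ ε) : ‖a + b‖ * μ.density x ≤ ε := by
  rcases le_max_iff.1 (IsUltrametricDist.norm_add_le_max a b) with h | h
  · exact (mul_le_mul_of_nonneg_right h (μ.density_nonneg x)).trans ha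
  · exact (mul_le_mul_of_nonneg_right h (μ.density_nonneg x)).trans hb

lemma sub_mul_density_le [IsUltrametricDist F] {a b : F} {x : X} {ε : ℝ}
    (ha : ‖a‖ * μ.density x ≤ ε) (hb : ‖b‖ * μ.density x ≤ ε) : ‖a - b‖ * μ.density x ≤ ε := by
  rw [sub_eq_add_neg]
  exact add_mul_density_le ha (by rwa [norm_neg])

/-- In the definition of the integral the step functions may be indexed by any finite type. -/
lemma HasIntegral.of_approx {f : X → F} {I : F}
    (h : ∀ ε > 0, ∃ (ι : Type) (_ : Fintype ι) (c : ι → F) (A : ι → Clopens X),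
      (∀ x, ‖f x - ∑ i, (A i : Set X).indicator (fun _ => c i) x‖ * μ.density x ≤ ε) ∧
      ‖I - ∑ i, c i * algebraMap L F (μ.toFun (A i))‖ ≤ ε) : μ.HasIntegral f I := by
  intro ε hε
  obtain ⟨ι, _, c, A, h1, h2⟩ := h ε hε
  let e := Fintype.equivFin ι
  refine ⟨Fintype.card ι, fun i => c (e.symm i), fun i => A (e.symm i), fun x => ?_, ?_⟩
  · rw [e.symm.sum_comp (fun i => (A i : Set X).indicator (fun _ => c i) x)]
    exact h1 x
  · rw [e.symm.sum_comp (fun i => c i * algebraMap L F (μ.toFun (A i)))]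
    exact h2

namespace HasIntegral

lemma const_mul {f : X → F} {I : F} (hf : μ.HasIntegral f I) (a : F) :
    μ.HasIntegral (fun x => a * f x) (a * I) := by
  intro ε hε
  obtain ⟨n, c, A, h1, h2⟩ := hf (ε / (‖a‖ + 1)) (by positivity)
  have h3 : ‖a‖ * (ε / (‖a‖ + 1)) ≤ ε := by
    rw [← mul_div_assoc, div_le_iff₀ (by positivity)]
    nlinarith [norm_nonneg a]
  refine ⟨n, fun i => a * c i, A, fun x => ?_, ?_⟩
  · have : ∀ i, (A i : Set X).indicator (fun _ => a * c i) x
        = a * (A i : Set X).indicator (fun _ => c i) x := fun i => by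
      by_cases hi : x ∈ (A i : Set X) <;> simp [hi]
    simp only [this]
    rw [← Finset.mul_sum, ← mul_sub, norm_mul, mul_assoc]
    exact (mul_le_mul_of_nonneg_left (h1 x) (norm_nonneg a)).trans h3
  · simp only [mul_assoc]
    rw [← Finset.mul_sum, ← mul_sub, norm_mul]
    exact (mul_le_mul_of_nonneg_left h2 (norm_nonneg a)).trans h3

lemma indicator (μ : TightMeasure X L) (A : Clopens X) (a : F) :
    μ.HasIntegral ((A : Set X).indicator fun _ => a) (a * algebraMap L F (μ.toFun A)) :=
  fun ε hε => ⟨1, fun _ => a, fun _ => A, by simp [hε.le], by simpa using hε.le⟩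

/-- Integrals over `L` become integrals over the extension `F`. -/
lemma map_algebraMap {f : X → L} {I : L} (h : μ.HasIntegral f I) :
    μ.HasIntegral (fun x => algebraMap L F (f x)) (algebraMap L F I) := by
  intro ε hε
  obtain ⟨n, c, A, h1, h2⟩ := h ε hε
  refine ⟨n, fun i => algebraMap L F (c i), A, fun x => ?_, ?_⟩
  · have : ∀ i, (A i : Set X).indicator (fun _ => algebraMap L F (c i)) x
        = algebraMap L F ((A i : Set X).indicator (fun _ => c i) x) := fun i => by
      by_cases hi : x ∈ (A i : Set X) <;> simp [hi]
    simp only [this]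
    rw [← map_sum, ← map_sub, norm_algebraMap']
    exact h1 x
  · simp only [Algebra.algebraMap_self_apply] at h2
    simp only [← map_mul]
    rw [← map_sum, ← map_sub, norm_algebraMap']
    exact h2

end HasIntegral

variable [IsUltrametricDist L] [IsUltrametricDist F]

/-- An additive set function that is small on small sets of a cover, and is controlled by the norm
of a measure, is small on the whole space. -/
lemma norm_top_le_of_locally (J : Clopens X → F)
    (hadd : ∀ A C, Disjoint A C → J (A ⊔ C) = J A + J C)
    {M : ℝ} (hM : ∀ C, ‖J C‖ ≤ M * μ.normOn C) {ε : ℝ} (hε : 0 < ε)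
    (hloc : ∀ x, ∃ V : Clopens X, x ∈ V ∧ ∀ C ≤ V, ‖J C‖ ≤ ε) : ‖J ⊤‖ ≤ ε := by
  classical
  choose V hxV hV using hloc
  obtain ⟨t, ht⟩ := μ.exists_finset_normOn_compl_le V hxV (ε := ε / (|M| + 1)) (by positivity)
  have key : ∀ t : Finset X, ∀ C ≤ t.sup V, ‖J C‖ ≤ ε := by
    intro t
    induction t using Finset.induction_on with
    | empty =>
      intro C hC
      have h0 := hadd ⊥ ⊥ disjoint_bot_left
      have : J ⊥ = 0 := by simpa using h0
      rw [show C = ⊥ by simpa using hC, this, norm_zero]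
      exact hε.le
    | insert a t _ ih =>
      intro C hC
      rw [Finset.sup_insert] at hC
      rw [← sup_inf_sdiff C (V a), hadd _ _ disjoint_inf_sdiff]
      exact (IsUltrametricDist.norm_add_le_max _ _).trans
        (max_le (hV a _ inf_le_right) (ih _ (sdiff_le_iff.2 hC)))
  rw [← sup_compl_eq_top (x := t.sup V), hadd _ _ disjoint_compl_right]
  refine (IsUltrametricDist.norm_add_le_max _ _).trans (max_le (key t _ le_rfl) ?_)
  calc ‖J (t.sup V)ᶜ‖ ≤ M * μ.normOn (t.sup V)ᶜ := hM _
    _ ≤ (|M| + 1) * (ε / (|M| + 1)) :=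
        mul_le_mul ((le_abs_self M).trans (by linarith)) ht (μ.normOn_nonneg _) (by positivity)
    _ = ε := by field_simp

/-- The integral of a step function is bounded by its seminorm. -/
lemma norm_step_le {ι : Type*} [Fintype ι] (c : ι → F) (A : ι → Clopens X) {ε : ℝ} (hε : 0 ≤ ε)
    (h : ∀ x, ‖∑ i, (A i : Set X).indicator (fun _ => c i) x‖ * μ.density x ≤ ε) :
    ‖∑ i, c i * algebraMap L F (μ.toFun (A i))‖ ≤ ε := by
  classical
  refine le_of_forall_gt_imp_ge_of_dense fun ε' hε' => ?_
  -- the step function times `μ`, as a set function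
  let J : Clopens X → F := fun C => ∑ i, c i * algebraMap L F (μ.toFun (A i ⊓ C))
  have hJ : J ⊤ = ∑ i, c i * algebraMap L F (μ.toFun (A i)) := by simp [J]
  rw [← hJ]
  refine norm_top_le_of_locally (μ := μ) J (fun C D hCD => ?_) (M := ∑ i, ‖c i‖) (fun C => ?_)
    (hε.trans_lt hε') fun x => ?_
  · simp only [J]
    rw [← Finset.sum_add_distrib]
    refine Finset.sum_congr rfl fun i _ => ?_
    rw [inf_sup_left, μ.additive _ _ (hCD.mono inf_le_right inf_le_right), map_add, mul_add]
  · rw [Finset.sum_mul]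
    refine (norm_sum_le _ _).trans (Finset.sum_le_sum fun i _ => ?_)
    rw [norm_mul, norm_algebraMap']
    exact mul_le_mul_of_nonneg_left (μ.norm_le_normOn inf_le_right) (norm_nonneg _)
  · set g : F := ∑ i, (A i : Set X).indicator (fun _ => c i) x with hg
    -- near `x` the set function is `g • μ`
    let V₀ : Clopens X := ⟨⋂ i, if x ∈ A i then (A i : Set X) else (A i : Set X)ᶜ,
      isClopen_iInter_of_finite fun i => by
        split_ifs
        · exact (A i).isClopen
        · exact (A i).isClopen.compl⟩
    have hxV₀ : x ∈ V₀ := by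
      refine Set.mem_iInter.2 fun i => ?_
      split_ifs with hi
      · exact hi
      · exact hi
    have hV₀ : ∀ C ≤ V₀, J C = g * algebraMap L F (μ.toFun C) := by
      intro C hC
      rw [hg, Finset.sum_mul]
      refine Finset.sum_congr rfl fun i _ => ?_
      have hCi : ∀ y ∈ C, y ∈ (if x ∈ A i then (A i : Set X) else (A i : Set X)ᶜ) :=
        fun y hy => Set.mem_iInter.1 (hC hy) i
      by_cases hi : x ∈ A i
      · rw [Set.indicator_of_mem hi, inf_eq_right.2]
        intro y hy
        simpa [hi] using hCi y hy
      · rw [Set.indicator_of_notMem hi, show A i ⊓ C = ⊥ from ?_, toFun_bot, map_zero, mul_zero,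
          zero_mul]
        refine disjoint_iff.1 (Clopens.coe_disjoint.1 (Set.disjoint_right.2 fun y hy => ?_))
        simpa [hi] using hCi y hy
    obtain ⟨V₁, hxV₁, hV₁⟩ : ∃ V₁ : Clopens X, x ∈ V₁ ∧ ‖g‖ * μ.normOn V₁ ≤ ε' := by
      rcases (norm_nonneg g).eq_or_lt with h0 | h0
      · exact ⟨⊤, Set.mem_univ x, by rw [← h0, zero_mul]; exact hε.trans hε'.le⟩
      · obtain ⟨V₁, hx, hlt⟩ := μ.exists_normOn_lt (x := x) (ε := ε' / ‖g‖) (by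
          rw [lt_div_iff₀ h0, mul_comm]
          exact (h x).trans_lt hε')
        rw [lt_div_iff₀ h0, mul_comm] at hlt
        exact ⟨V₁, hx, hlt.le⟩
    refine ⟨V₀ ⊓ V₁, ⟨hxV₀, hxV₁⟩, fun C hC => ?_⟩
    rw [hV₀ C (hC.trans inf_le_left), norm_mul, norm_algebraMap']
    exact (mul_le_mul_of_nonneg_left (μ.norm_le_normOn (hC.trans inf_le_right))
      (norm_nonneg _)).trans hV₁

namespace HasIntegral

variable {f g : X → F} {I J : F}

lemma norm_le (h : μ.HasIntegral f I) {ε : ℝ} (hε : 0 ≤ ε)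
    (hf : ∀ x, ‖f x‖ * μ.density x ≤ ε) : ‖I‖ ≤ ε := by
  refine le_of_forall_pos_le_add fun η hη => ?_
  obtain ⟨n, c, A, h1, h2⟩ := h η hη
  have h3 : ‖∑ i, c i * algebraMap L F (μ.toFun (A i))‖ ≤ ε + η := by
    refine norm_step_le c A (by positivity) fun x => ?_
    rw [← sub_sub_cancel (f x) (∑ i, (A i : Set X).indicator (fun _ => c i) x)]
    exact sub_mul_density_le ((hf x).trans (by linarith)) ((h1 x).trans (by linarith))
  rw [← sub_add_cancel I (∑ i, c i * algebraMap L F (μ.toFun (A i)))]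
  exact (IsUltrametricDist.norm_add_le_max _ _).trans (max_le (h2.trans (by linarith)) h3)

lemma add (hf : μ.HasIntegral f I) (hg : μ.HasIntegral g J) :
    μ.HasIntegral (fun x => f x + g x) (I + J) := by
  refine .of_approx fun ε hε => ?_
  obtain ⟨n, c, A, h1, h2⟩ := hf ε hε
  obtain ⟨m, d, C, h3, h4⟩ := hg ε hε
  refine ⟨Fin n ⊕ Fin m, inferInstance, Sum.elim c d, Sum.elim A C, fun x => ?_, ?_⟩
  · rw [Fintype.sum_sum_type]
    simp only [Sum.elim_inl, Sum.elim_inr]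
    rw [add_sub_add_comm]
    exact add_mul_density_le (h1 x) (h3 x)
  · rw [Fintype.sum_sum_type]
    simp only [Sum.elim_inl, Sum.elim_inr]
    rw [add_sub_add_comm]
    exact (IsUltrametricDist.norm_add_le_max _ _).trans (max_le h2 h4)

lemma sub (hf : μ.HasIntegral f I) (hg : μ.HasIntegral g J) :
    μ.HasIntegral (fun x => f x - g x) (I - J) := by
  have h := hf.add (hg.const_mul (-1))
  simpa only [neg_one_mul, ← sub_eq_add_neg] using h

lemma sum {ι : Type*} (s : Finset ι) {f : ι → X → F} {I : ι → F}
    (h : ∀ i ∈ s, μ.HasIntegral (f i) (I i)) :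
    μ.HasIntegral (fun x => ∑ i ∈ s, f i x) (∑ i ∈ s, I i) := by
  classical
  induction s using Finset.induction_on with
  | empty => simpa using indicator μ ⊥ (0 : F)
  | insert a s ha ih =>
    simp only [Finset.sum_insert ha]
    exact (h a (Finset.mem_insert_self a s)).add
      (ih fun i hi => h i (Finset.mem_insert_of_mem hi))

lemma norm_sub_le (hf : μ.HasIntegral f I) (hg : μ.HasIntegral g J) {ε : ℝ} (hε : 0 ≤ ε)
    (h : ∀ x, ‖f x - g x‖ * μ.density x ≤ ε) : ‖I - J‖ ≤ ε :=
  (hf.sub hg).norm_le hε h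

lemma unique (hf : μ.HasIntegral f I) (hg : μ.HasIntegral f J) : I = J := by
  have := hf.norm_sub_le hg le_rfl (by simp)
  exact sub_eq_zero.1 (norm_le_zero_iff.1 this)

/-- The class of integrable functions is closed under limits in the seminorm. -/
lemma of_forall
    (h : ∀ ε > 0, ∃ (g : X → F) (J : F), μ.HasIntegral g J ∧
      (∀ x, ‖f x - g x‖ * μ.density x ≤ ε) ∧ ‖I - J‖ ≤ ε) : μ.HasIntegral f I := by
  intro ε hε
  obtain ⟨g, J, hg, h1, h2⟩ := h ε hε
  obtain ⟨n, c, A, h3, h4⟩ := hg ε hε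
  refine ⟨n, c, A, fun x => ?_, ?_⟩
  · rw [← sub_add_sub_cancel (f x) (g x)]
    exact add_mul_density_le (h1 x) (h3 x)
  · rw [← sub_add_sub_cancel I J]
    exact (IsUltrametricDist.norm_add_le_max _ _).trans (max_le h2 h4)

end HasIntegral

lemma exists_hasIntegral_of_approx [CompleteSpace F] {f : X → F}
    (h : ∀ ε > 0, ∃ (g : X → F) (J : F), μ.HasIntegral g J ∧
      ∀ x, ‖f x - g x‖ * μ.density x ≤ ε) : ∃ I, μ.HasIntegral f I := by
  choose g J hg hfg using fun n : ℕ => h (1 / ((n : ℝ) + 1)) Nat.one_div_pos_of_nat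
  have hJ : ∀ N n m : ℕ, N ≤ n → N ≤ m → ‖J n - J m‖ ≤ 1 / ((N : ℝ) + 1) := by
    intro N n m hn hm
    refine (hg n).norm_sub_le (hg m) Nat.one_div_pos_of_nat.le fun x => ?_
    rw [← sub_sub_sub_cancel_left (g m x) (g n x) (f x)]
    exact sub_mul_density_le ((hfg m x).trans (Nat.one_div_le_one_div hm))
      ((hfg n x).trans (Nat.one_div_le_one_div hn))
  have hc : CauchySeq J := by
    refine cauchySeq_of_le_tendsto_0 (fun N : ℕ => 1 / ((N : ℝ) + 1)) (fun n m N hn hm => ?_)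
      tendsto_one_div_add_atTop_nhds_zero_nat
    rw [dist_eq_norm]
    exact hJ N n m hn hm
  obtain ⟨I, hI⟩ := cauchySeq_tendsto_of_complete hc
  refine ⟨I, .of_forall fun ε hε => ?_⟩
  obtain ⟨N, hN⟩ := exists_nat_one_div_lt hε
  refine ⟨g N, J N, hg N, fun x => (hfg N x).trans hN.le, ?_⟩
  refine le_trans ?_ hN.le
  refine le_of_tendsto ((hI.sub_const (J N)).norm) ?_
  filter_upwards [eventually_ge_atTop N] with n hn
  exact hJ N n N hn le_rfl

/-- A bounded function that is locally almost constant on clopen sets is integrable. -/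
lemma exists_hasIntegral [CompleteSpace F] {f : X → F} {M : ℝ} (hM : ∀ x, ‖f x‖ ≤ M)
    (hf : ∀ x, ∀ ε > 0, ∃ V : Clopens X, x ∈ V ∧ ∀ y ∈ V, ‖f y - f x‖ ≤ ε) :
    ∃ I, μ.HasIntegral f I := by
  classical
  refine exists_hasIntegral_of_approx (μ := μ) fun ε hε => ?_
  obtain ⟨c, hc1, -, hc⟩ := μ.exists_bound
  choose V hxV hV using fun x => hf x (ε / c) (by positivity)
  obtain ⟨t, ht⟩ := μ.exists_finset_normOn_compl_le V hxV (ε := ε / (|M| + 1)) (by positivity)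
  have key : ∀ t : Finset X, ∃ (g : X → F) (J : F), μ.HasIntegral g J ∧
      (∀ x ∈ t.sup V, ‖f x - g x‖ ≤ ε / c) ∧ ∀ x ∉ t.sup V, g x = 0 := by
    intro t
    induction t using Finset.induction_on with
    | empty =>
      exact ⟨_, _, HasIntegral.indicator μ ⊥ (0 : F), by
        intro x hx
        exact absurd hx (by simp [← SetLike.mem_coe]), by simp⟩
    | insert a t _ ih =>
      obtain ⟨g, J, hg, h1, h2⟩ := ih
      refine ⟨_, _, hg.add (HasIntegral.indicator μ (V a \ t.sup V) (f a)), fun x hx => ?_,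
        fun x hx => ?_⟩
      · by_cases hxt : x ∈ t.sup V
        · rw [Set.indicator_of_notMem fun h => h.2 hxt, add_zero]
          exact h1 x hxt
        · rw [Finset.sup_insert] at hx
          have hxa : x ∈ V a := hx.resolve_right hxt
          rw [Set.indicator_of_mem (show x ∈ ((V a \ t.sup V : Clopens X) : Set X) from ⟨hxa, hxt⟩),
            h2 x hxt, zero_add]
          exact hV a x hxa
      · rw [Finset.sup_insert] at hx
        rw [h2 x fun h => hx (Or.inr h), Set.indicator_of_notMem fun h => hx (Or.inl h.1), add_zero]
  obtain ⟨g, J, hg, h1, h2⟩ := key t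
  refine ⟨g, J, hg, fun x => ?_⟩
  by_cases hx : x ∈ t.sup V
  · calc ‖f x - g x‖ * μ.density x ≤ ε / c * c :=
          mul_le_mul (h1 x hx) (hc x) (μ.density_nonneg x) (by positivity)
      _ = ε := by field_simp
  · rw [h2 x hx, sub_zero]
    calc ‖f x‖ * μ.density x ≤ (|M| + 1) * (ε / (|M| + 1)) :=
          mul_le_mul ((hM x).trans ((le_abs_self M).trans (by linarith)))
            ((μ.density_le (A := (t.sup V)ᶜ) hx).trans ht) (μ.density_nonneg x) (by positivity)
      _ = ε := by field_simp

end Integral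

end TightMeasure

/-! ### Convolutions on a non-Archimedean group -/

section Convolution

variable {X : Type*} [AddCommGroup X] [TopologicalSpace X] [NonarchimedeanAddGroup X]

lemma isClopen_of_add_mem (U : OpenAddSubgroup X) {E : Set X}
    (hE : ∀ x ∈ E, ∀ u ∈ U, x + u ∈ E) : IsClopen E := by
  have key : ∀ E : Set X, (∀ x ∈ E, ∀ u ∈ U, x + u ∈ E) → IsOpen E := by
    intro E hE
    refine isOpen_iff_mem_nhds.2 fun x hx => ?_
    have h : (fun y => y - x) ⁻¹' (U : Set X) ∈ 𝓝 x :=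
      (U.isOpen.preimage (by fun_prop)).mem_nhds (by simp)
    filter_upwards [h] with y hy
    simpa using hE x hx _ hy
  refine ⟨⟨key _ fun x hx u hu h => hx ?_⟩, key E hE⟩
  simpa using hE _ h (-u) (U.neg_mem hu)

/-- The coset `x + U` of an open subgroup. -/
def coset (U : OpenAddSubgroup X) (x : X) : Clopens X :=
  ⟨{y | y - x ∈ U}, isClopen_of_add_mem U fun y hy u hu => by
    have : y + u - x = (y - x) + u := by abel
    rw [Set.mem_ofPred_eq, this]
    exact U.add_mem hy hu⟩

lemma mem_coset {U : OpenAddSubgroup X} {x y : X} : y ∈ coset U x ↔ y - x ∈ U := Iff.rfl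

lemma self_mem_coset (U : OpenAddSubgroup X) (x : X) : x ∈ coset U x := by
  simp [mem_coset]

lemma mem_translate {A : Clopens X} {x y : X} : y ∈ translate A x ↔ y + x ∈ A := Iff.rfl

lemma exists_openAddSubgroup_add_mem_iff (A : Clopens X) (x : X) :
    ∃ U : OpenAddSubgroup X, ∀ u ∈ U, (x + u ∈ A ↔ x ∈ A) := by
  have key : ∀ A : Clopens X, x ∈ A → ∃ U : OpenAddSubgroup X, ∀ u ∈ U, x + u ∈ A := by
    intro A hx
    obtain ⟨U, hU⟩ := NonarchimedeanAddGroup.is_nonarchimedean ((fun u => x + u) ⁻¹' (A : Set X))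
      ((A.isOpen.preimage (by fun_prop)).mem_nhds (by simpa using hx))
    exact ⟨U, fun u hu => hU hu⟩
  by_cases hx : x ∈ A
  · obtain ⟨U, hU⟩ := key A hx
    exact ⟨U, fun u hu => iff_of_true (hU u hu) hx⟩
  · obtain ⟨U, hU⟩ := key Aᶜ hx
    exact ⟨U, fun u hu => iff_of_false (hU u hu) hx⟩

namespace TightMeasure

variable {L : Type*} [NormedField L] [IsUltrametricDist L] (μ ν : TightMeasure X L)

/-- A clopen set is almost invariant under a small open subgroup `U`: the points whose `U`-coset
meets both the set and its complement form a clopen set of small norm. -/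
lemma exists_almost_invariant (A : Clopens X) {ε : ℝ} (hε : 0 < ε) :
    ∃ (U : OpenAddSubgroup X) (E : Clopens X), μ.normOn E ≤ ε ∧
      ∀ u ∈ U, ∀ y ∉ E, (y + u ∈ A ↔ y ∈ A) := by
  let E : OpenAddSubgroup X → Clopens X := fun U => ⟨{x | ∃ u ∈ U, ¬ (x + u ∈ A ↔ x ∈ A)},
    isClopen_of_add_mem U (by
      rintro x ⟨u, hu, h⟩ v hv
      by_cases hxv : x + v ∈ A ↔ x ∈ A
      · refine ⟨u - v, U.sub_mem hu hv, ?_⟩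
        rwa [add_add_sub_cancel, hxv]
      · refine ⟨-v, U.neg_mem hv, ?_⟩
        rwa [add_neg_cancel_right, iff_comm])⟩
  have hdir : ∀ U V, ∃ W, E W ≤ E U ⊓ E V := fun U V =>
    ⟨U ⊓ V, le_inf (fun x ⟨u, hu, h⟩ => ⟨u, hu.1, h⟩) fun x ⟨u, hu, h⟩ => ⟨u, hu.2, h⟩⟩
  have hempty : ∀ x, ∃ U, x ∉ E U := fun x => by
    obtain ⟨U, hU⟩ := exists_openAddSubgroup_add_mem_iff A x
    exact ⟨U, fun ⟨u, hu, h⟩ => h (hU u hu)⟩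
  obtain ⟨U, hU⟩ := μ.exists_normOn_le E hdir hempty hε
  refine ⟨U, E U, hU, fun u hu y hy => ?_⟩
  by_contra h
  exact hy ⟨u, hu, h⟩

/-- The function `x ↦ μ(A - x)` is continuous, and `x ↦ ‖A - x‖_μ` is almost locally bounded by its
value at a point. -/
lemma exists_translate_close (A : Clopens X) (x : X) {ε : ℝ} (hε : 0 < ε) :
    ∃ V : Clopens X, x ∈ V ∧ ∀ y ∈ V,
      ‖μ.toFun (translate A y) - μ.toFun (translate A x)‖ ≤ ε ∧
      μ.normOn (translate A y) ≤ max (μ.normOn (translate A x)) ε := by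
  obtain ⟨U, E, hE, h⟩ := μ.exists_almost_invariant (translate A x) hε
  refine ⟨coset U x, self_mem_coset U x, fun y hy => ?_⟩
  have h' : ∀ w ∉ E, (w ∈ translate A y ↔ w ∈ translate A x) := by
    intro w hw
    rw [← h _ (mem_coset.1 hy) w hw, mem_translate, mem_translate,
      show w + (y - x) + x = w + y by abel]
  exact ⟨(μ.norm_sub_le_of_mem_iff h').trans hE, (μ.normOn_mono (le_sup_of_mem_iff h')).trans
    ((μ.norm_sup_le).trans (max_le_max le_rfl hE))⟩

lemma translate_sup (A C : Clopens X) (x : X) :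
    translate (A ⊔ C) x = translate A x ⊔ translate C x := rfl

lemma translate_mono {A C : Clopens X} (h : A ≤ C) (x : X) : translate A x ≤ translate C x :=
  fun _ hy => h hy

lemma disjoint_translate {A C : Clopens X} (h : Disjoint A C) (x : X) :
    Disjoint (translate A x) (translate C x) := by
  rw [← Clopens.coe_disjoint] at h ⊢
  exact h.preimage _

/-- If `A` runs through a shrinking family, then `x ↦ μ(A - x)` tends to zero in the seminorm of
`ν`. -/
lemma exists_translate_small (S : Set (Clopens X)) (hne : S.Nonempty)
    (hdir : ∀ A ∈ S, ∀ C ∈ S, ∃ D ∈ S, D ≤ A ⊓ C) (hempty : (⋂ A ∈ S, (A : Set X)) = ∅)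
    {ε : ℝ} (hε : 0 < ε) :
    ∃ A₀ ∈ S, ∀ A ≤ A₀, ∀ x, ‖μ.toFun (translate A x)‖ * ν.density x ≤ ε := by
  classical
  obtain ⟨c, hc1, hcA, -⟩ := μ.exists_bound
  obtain ⟨d, hd1, -, hd⟩ := ν.exists_bound
  have hlow : ∀ x, ∃ A ∈ S, μ.normOn (translate A x) ≤ ε / d := by
    intro x
    have : Nonempty S := hne.to_subtype
    suffices h : ∃ A : S, μ.normOn (translate A.1 x) ≤ ε / d by
      obtain ⟨A, hA⟩ := h
      exact ⟨A.1, A.2, hA⟩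
    refine μ.exists_normOn_le (fun A : S => translate A.1 x)
      (fun A C => ?_) (fun y => ?_) (by positivity)
    · obtain ⟨D, hD, h⟩ := hdir A.1 A.2 C.1 C.2
      exact ⟨⟨D, hD⟩, le_inf (translate_mono (h.trans inf_le_left) x)
        (translate_mono (h.trans inf_le_right) x)⟩
    · by_contra! hy
      have : y + x ∈ ⋂ A ∈ S, (A : Set X) := Set.mem_iInter₂.2 fun A hA => hy ⟨A, hA⟩
      rwa [hempty] at this
  choose A hAS hA using hlow
  choose V hxV hV using fun x => μ.exists_translate_close (A x) x (show 0 < ε / d by positivity)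
  obtain ⟨t, ht⟩ := ν.exists_finset_normOn_compl_le V hxV (ε := ε / c) (by positivity)
  -- a member of the family below all `A x`, `x ∈ t`
  have hmin : ∀ t : Finset X, ∃ A₀ ∈ S, ∀ x ∈ t, A₀ ≤ A x := by
    intro t
    induction t using Finset.induction_on with
    | empty =>
      obtain ⟨A₀, h⟩ := hne
      exact ⟨A₀, h, by simp⟩
    | insert a t _ ih =>
      obtain ⟨A₀, h0, h⟩ := ih
      obtain ⟨D, hD, hD'⟩ := hdir A₀ h0 (A a) (hAS a)
      refine ⟨D, hD, fun x hx => ?_⟩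
      rcases Finset.mem_insert.1 hx with rfl | hx
      · exact hD'.trans inf_le_right
      · exact (hD'.trans inf_le_left).trans (h x hx)
  obtain ⟨A₀, hA₀, h⟩ := hmin t
  refine ⟨A₀, hA₀, fun C hC y => ?_⟩
  by_cases hy : y ∈ t.sup V
  · rw [← SetLike.mem_coe, Clopens.coe_finset_sup] at hy
    obtain ⟨x, hx, hyx⟩ := Set.mem_iUnion₂.1 hy
    have h1 : ‖μ.toFun (translate C y)‖ ≤ ε / d :=
      (μ.norm_le_normOn (translate_mono (hC.trans (h x hx)) y)).trans
        (((hV x y hyx).2).trans (max_le (hA x) le_rfl))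
    calc _ ≤ ε / d * d := mul_le_mul h1 (hd y) (ν.density_nonneg y) (by positivity)
      _ = ε := by field_simp
  · calc _ ≤ c * (ε / c) := mul_le_mul ((μ.norm_le_normOn le_rfl).trans (hcA _))
          ((ν.density_le (A := (t.sup V)ᶜ) hy).trans ht) (ν.density_nonneg y) (by positivity)
      _ = ε := by field_simp

theorem exists_isConvolution [CompleteSpace L] : ∃ ρ, IsConvolution μ ν ρ := by
  obtain ⟨c, hc1, hcA, -⟩ := μ.exists_bound
  obtain ⟨d, hd1, -, hd⟩ := ν.exists_bound
  have hc : ∀ A, ‖μ.toFun A‖ ≤ c := fun A => (μ.norm_le_normOn le_rfl).trans (hcA A)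
  have hex : ∀ A, ∃ I : L, ν.HasIntegral (fun x => μ.toFun (translate A x)) I := fun A =>
    exists_hasIntegral (fun x => hc (translate A x)) fun x ε hε => by
      obtain ⟨V, hx, hV⟩ := μ.exists_translate_close A x hε
      exact ⟨V, hx, fun y hy => (hV y hy).1⟩
  choose r hr using hex
  refine ⟨⟨r, fun A C hAC => ?_, ⟨c * d, fun A => ?_⟩, fun S hne hdir hempty ε hε => ?_⟩, hr⟩
  · refine (hr (A ⊔ C)).unique ?_
    have h : ∀ x, μ.toFun (translate (A ⊔ C) x)
        = μ.toFun (translate A x) + μ.toFun (translate C x) := fun x => by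
      rw [translate_sup, μ.additive _ _ (disjoint_translate hAC x)]
    simp only [h]
    exact (hr A).add (hr C)
  · exact (hr A).norm_le (by positivity) fun x =>
      mul_le_mul (hc _) (hd x) (ν.density_nonneg x) (by positivity)
  · obtain ⟨A₀, hA₀, h⟩ := μ.exists_translate_small ν S hne hdir hempty hε
    exact ⟨A₀, hA₀, fun A _ hA => (hr A).norm_le hε.le (h A hA)⟩

end TightMeasure

lemma IsConvolution.unique {L : Type*} [NormedField L] [IsUltrametricDist L]
    {μ ν ρ ρ' : TightMeasure X L} (h : IsConvolution μ ν ρ) (h' : IsConvolution μ ν ρ') :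
    ρ' = ρ := by
  ext A
  exact (h' A).unique (h A)

end Convolution

/-! ### Characters of the field -/

section Character

variable {K F : Type*} [NontriviallyNormedField K] [NormedField F]

/-- A character of `K` that is trivial near zero and has values of `p`-power order, of bounded order
on bounded sets. -/
structure IsTame (p : ℕ) (χ : AddChar K F) : Prop where
  exists_radius : ∃ r > 0, ∀ y, ‖y‖ ≤ r → χ y = 1
  exists_pow : ∀ R : ℝ, ∃ n : ℕ, ∀ y, ‖y‖ ≤ R → χ y ^ p ^ n = 1

lemma norm_eq_one_of_pow_eq_one {ζ : F} {m : ℕ} (hm : m ≠ 0) (h : ζ ^ m = 1) : ‖ζ‖ = 1 :=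
  (isOfFinOrder_iff_pow_eq_one.2 ⟨m, Nat.pos_of_ne_zero hm, h⟩).norm_eq_one

lemma norm_geom_sum_le [IsUltrametricDist F] {ζ : F} (h : ‖ζ‖ = 1) (m : ℕ) :
    ‖∑ i ∈ Finset.range m, ζ ^ i‖ ≤ 1 :=
  IsUltrametricDist.norm_sum_le_of_forall_le_of_nonneg zero_le_one fun i _ => by
    rw [norm_pow, h, one_pow]

lemma geom_sum_eq_zero {ζ : F} {m : ℕ} (h : ζ ^ m = 1) (h1 : ζ ≠ 1) :
    ∑ i ∈ Finset.range m, ζ ^ i = 0 := by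
  rw [geom_sum_eq h1, h, sub_self, zero_div]

/-- A nontrivial root of unity whose order is prime to the residue characteristic is not congruent
to `1`: for `ζ ^ m = 1` one has `m = -∑_{i < m} (ζ ^ i - 1)`. -/
lemma one_le_norm_sub_one [IsUltrametricDist F] {ζ : F} {m : ℕ} (hm : ‖(m : F)‖ = 1)
    (h : ζ ^ m = 1) (h1 : ζ ≠ 1) : 1 ≤ ‖ζ - 1‖ := by
  have hm0 : m ≠ 0 := by
    rintro rfl
    simp at hm
  have hζ := norm_eq_one_of_pow_eq_one hm0 h
  have hsum : (m : F) = -∑ i ∈ Finset.range m, (ζ ^ i - 1) := by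
    rw [Finset.sum_sub_distrib, geom_sum_eq_zero h h1]
    simp
  rw [← hm, hsum, norm_neg]
  refine IsUltrametricDist.norm_sum_le_of_forall_le_of_nonneg (norm_nonneg _) fun i _ => ?_
  rw [← geom_sum_mul, norm_mul]
  exact mul_le_of_le_one_left (norm_nonneg _) (norm_geom_sum_le hζ i)

lemma tendsto_pow_nsmul {p : ℕ} (hpK : ‖(p : K)‖ < 1) (x : K) :
    Tendsto (fun n : ℕ => p ^ n • x) atTop (𝓝 0) := by
  have h := (tendsto_pow_atTop_nhds_zero_of_norm_lt_one hpK).mul_const x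
  simpa [nsmul_eq_mul] using h

lemma IsTame.isLocallyConstant {p : ℕ} {χ : AddChar K F} (hχ : IsTame p χ) : IsLocallyConstant χ := by
  refine (IsLocallyConstant.iff_eventually_eq _).2 fun x => ?_
  obtain ⟨r, hr, h⟩ := hχ.exists_radius
  filter_upwards [Metric.closedBall_mem_nhds x hr] with y hy
  rw [← sub_add_cancel y x, χ.map_add_eq_mul, h _ (by rwa [← mem_closedBall_iff_norm]), one_mul]

variable {p : ℕ} [Fact p.Prime] {χ : AddChar K F}

lemma exists_pow_prime_eq_one (hpK : ‖(p : K)‖ < 1) (hχ : Continuous χ)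
    (hroot : ∀ x, IsOfFinOrder (χ x)) (x : K) : ∃ n : ℕ, χ x ^ p ^ n = 1 := by
  have hp : p.Prime := Fact.out
  obtain ⟨a, d, hd, hord⟩ := Nat.exists_eq_pow_mul_and_not_dvd (hroot x).orderOf_pos.ne' p
    hp.one_lt.ne'
  refine ⟨a, ?_⟩
  set η := χ x ^ p ^ a with hη
  have hηd : η ^ d = 1 := by rw [hη, ← pow_mul, ← hord, pow_orderOf_eq_one]
  have hd0 : 0 < d := Nat.pos_of_ne_zero fun h => hd (h ▸ dvd_zero p)
  -- `p ^ φ ≡ 1` modulo the order of `η`, hence `η` is a constant subsequence of `χ(p ^ n x) → 1`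
  set φ := d.totient
  have hφ0 : φ ≠ 0 := (Nat.totient_pos.2 hd0).ne'
  obtain ⟨k, hk⟩ : ∃ k, p ^ φ = 1 + d * k := by
    have h := Nat.ModEq.pow_totient ((Nat.Prime.coprime_iff_not_dvd hp).2 hd)
    obtain ⟨k, hk⟩ := (Nat.modEq_iff_dvd' (Nat.one_le_pow _ _ hp.pos)).1 h.symm
    refine ⟨k, ?_⟩
    rw [← hk, Nat.add_sub_cancel' (Nat.one_le_pow _ _ hp.pos)]
  have hstep : η ^ p ^ φ = η := by
    rw [hk, pow_add, pow_mul, hηd, one_pow, mul_one, pow_one]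
  have hfix : ∀ n : ℕ, η ^ p ^ (φ * n) = η := by
    intro n
    induction n with
    | zero => simp
    | succ n ih => rw [Nat.mul_succ, pow_add, pow_mul, ih, hstep]
  have hlim : Tendsto (fun n : ℕ => χ (p ^ (φ * n) • (p ^ a • x))) atTop (𝓝 (χ 0)) :=
    (hχ.tendsto 0).comp ((tendsto_pow_nsmul hpK (p ^ a • x)).comp
      (tendsto_id.const_mul_atTop' (Nat.pos_of_ne_zero hφ0)))
  have hconst : ∀ n : ℕ, χ (p ^ (φ * n) • (p ^ a • x)) = η := fun n => by
    rw [χ.map_nsmul_eq_pow, χ.map_nsmul_eq_pow, ← hη, hfix]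
  simp only [hconst, AddChar.map_zero_eq_one] at hlim
  exact tendsto_nhds_unique tendsto_const_nhds hlim

lemma isTame_of_continuous [IsUltrametricDist F] (hpK : ‖(p : K)‖ < 1) (hpF : ‖(p : F)‖ = 1)
    (hχ : Continuous χ) (hroot : ∀ x, IsOfFinOrder (χ x)) : IsTame p χ := by
  have hrad : ∃ r > 0, ∀ y, ‖y‖ ≤ r → χ y = 1 := by
    have h := hχ.tendsto 0
    rw [AddChar.map_zero_eq_one] at h
    obtain ⟨r, hr, h⟩ := Metric.eventually_nhds_iff_ball.1
      (h.eventually (Metric.ball_mem_nhds 1 one_pos))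
    refine ⟨r / 2, by positivity, fun y hy => ?_⟩
    by_contra h1
    obtain ⟨n, hn⟩ := exists_pow_prime_eq_one hpK hχ hroot y
    have h2 := one_le_norm_sub_one (by rw [Nat.cast_pow, norm_pow, hpF, one_pow]) hn h1
    have h3 := h y (by rw [mem_ball_zero_iff]; linarith)
    rw [dist_eq_norm] at h3
    linarith
  refine ⟨hrad, fun R => ?_⟩
  obtain ⟨r, hr, h⟩ := hrad
  obtain ⟨n, hn⟩ := exists_pow_lt_of_lt_one (show 0 < r / (|R| + 1) by positivity) hpK
  refine ⟨n, fun y hy => ?_⟩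
  rw [← χ.map_nsmul_eq_pow]
  refine h _ ?_
  rw [nsmul_eq_mul, norm_mul, Nat.cast_pow, norm_pow]
  rw [lt_div_iff₀ (by positivity)] at hn
  refine le_trans ?_ hn.le
  gcongr
  exact hy.trans ((le_abs_self R).trans (by linarith))

lemma IsTame.norm_eq_one (hχ : IsTame p χ) (y : K) : ‖χ y‖ = 1 := by
  obtain ⟨n, hn⟩ := hχ.exists_pow ‖y‖
  exact norm_eq_one_of_pow_eq_one (pow_pos (Fact.out : p.Prime).pos n).ne' (hn y le_rfl)

end Character

/-! ### Windows: the bounded parts of a functional -/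

section Window

variable {K F : Type*} [NontriviallyNormedField K] [IsUltrametricDist K] [NormedField F]
  {X : Type*} [AddCommGroup X] [TopologicalSpace X]

/-- The clopen subgroup `{x | |z(x)| ≤ n + 1}`. -/
def window (z : X →+ K) (hz : Continuous z) (n : ℕ) : Clopens X :=
  ⟨z ⁻¹' Metric.closedBall 0 (n + 1),
    (IsUltrametricDist.isClopen_closedBall 0 (by positivity)).preimage hz⟩

variable {z : X →+ K} {hz : Continuous z}

lemma mem_window_iff {n : ℕ} {x : X} :
    x ∈ window z hz n ↔ ‖z x‖ ≤ n + 1 :=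
  mem_closedBall_zero_iff

lemma window_mono {m n : ℕ} (h : m ≤ n) : window z hz m ≤ window z hz n := by
  intro x hx
  rw [mem_window_iff] at hx ⊢
  exact hx.trans (by gcongr)

lemma add_mem_window_iff {n : ℕ} {x y : X} (hx : x ∈ window z hz n) :
    y + x ∈ window z hz n ↔ y ∈ window z hz n := by
  rw [mem_window_iff] at hx
  rw [mem_window_iff, mem_window_iff]
  constructor
  · intro h
    rw [← add_sub_cancel_right (z y) (z x), ← map_add, sub_eq_add_neg]
    exact (IsUltrametricDist.norm_add_le_max _ _).trans (max_le h (by rwa [norm_neg]))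
  · intro h
    rw [map_add]
    exact (IsUltrametricDist.norm_add_le_max _ _).trans (max_le h hx)

lemma exists_window {L : Type*} [NormedField L] [IsUltrametricDist L] (μ : TightMeasure X L)
    (z : X →+ K) (hz : Continuous z) {ε : ℝ} (hε : 0 < ε) :
    ∃ N, ∀ n ≥ N, μ.normOn (window z hz n)ᶜ ≤ ε := by
  obtain ⟨N, hN⟩ := μ.exists_normOn_le (fun n => (window z hz n)ᶜ) (fun m n => ⟨max m n, le_inf
    (compl_le_compl (window_mono (le_max_left _ _)))
    (compl_le_compl (window_mono (le_max_right _ _)))⟩) (fun x => by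
      obtain ⟨n, hn⟩ := exists_nat_ge ‖z x‖
      exact ⟨n, fun h => h (mem_window_iff.2 (hn.trans (by linarith)))⟩) hε
  exact ⟨N, fun n hn => (μ.normOn_mono (compl_le_compl (window_mono hn))).trans hN⟩

variable {p : ℕ} {χ : AddChar K F}

/-- The part of the window on which the character `χ ∘ z` has the value `ζ`. -/
def fiber (hχ : IsTame p χ) (z : X →+ K) (hz : Continuous z) (n : ℕ) (ζ : F) : Clopens X :=
  window z hz n ⊓ ⟨{x | χ (z x) = ζ}, (hχ.isLocallyConstant.comp_continuous hz).isClopen_fiber ζ⟩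

/-- On a window, a character is a step function, with roots of unity as its values. -/
lemma exists_eq_sum_fiber [Fact p.Prime] (hχ : IsTame p χ) (z : X →+ K) (hz : Continuous z)
    (n : ℕ) : ∃ Z : Finset F, (∀ ζ ∈ Z, ‖ζ‖ = 1) ∧
      ∀ x, (window z hz n : Set X).indicator (fun x => χ (z x)) x =
        ∑ ζ ∈ Z, (fiber hχ z hz n ζ : Set X).indicator (fun _ => ζ) x := by
  classical
  obtain ⟨m, hm⟩ := hχ.exists_pow (n + 1)
  have hpm : 0 < p ^ m := pow_pos (Fact.out : p.Prime).pos m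
  refine ⟨Polynomial.nthRootsFinset (p ^ m) (1 : F), fun ζ hζ => ?_, fun x => ?_⟩
  · exact norm_eq_one_of_pow_eq_one hpm.ne' ((Polynomial.mem_nthRootsFinset hpm 1).1 hζ)
  · by_cases hx : x ∈ window z hz n
    · rw [Set.indicator_of_mem hx, Finset.sum_eq_single (χ (z x)), Set.indicator_of_mem]
      · exact ⟨hx, rfl⟩
      · intro ζ _ hne
        exact Set.indicator_of_notMem (fun h => hne h.2.symm) _
      · intro h
        exact absurd ((Polynomial.mem_nthRootsFinset hpm 1).2 (hm _ (mem_window_iff.1 hx))) h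
    · rw [Set.indicator_of_notMem hx, Finset.sum_eq_zero]
      intro ζ _
      exact Set.indicator_of_notMem (fun h => hx h.1) _

end Window

/-! ### The characteristic functional of a convolution -/

open TightMeasure

section CharFun

variable {K F L : Type*} [NontriviallyNormedField K] [IsUltrametricDist K] [NormedField F]
  [NormedField L] [NormedAlgebra L F] [IsUltrametricDist L] [IsUltrametricDist F]
  {X : Type*} [AddCommGroup X] [TopologicalSpace X] [NonarchimedeanAddGroup X]

/-- The characteristic functional of a convolution is the product of the characteristic functionals:
on a window `W` the truncation `h` of the character satisfies `h (y + x) = χ(z(x)) h(y)` for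
`x ∈ W`, and outside the windows the measures are small. -/
theorem IsConvolution.hasIntegral_char {p : ℕ} [Fact p.Prime] {χ : AddChar K F} (hχ : IsTame p χ)
    {μ ν ρ : TightMeasure X L} (hρ : IsConvolution μ ν ρ) (z : X →+ K) (hz : Continuous z) {I J : F}
    (hI : μ.HasIntegral (fun x => χ (z x)) I) (hJ : ν.HasIntegral (fun x => χ (z x)) J) :
    ρ.HasIntegral (fun x => χ (z x)) (I * J) := by
  obtain ⟨c, hc1, -, hc⟩ := μ.exists_bound
  obtain ⟨d, hd1, -, hd⟩ := ν.exists_bound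
  refine .of_forall fun ε hε => ?_
  set M := c + d
  obtain ⟨N₁, h₁⟩ := exists_window μ z hz (show 0 < ε / M by positivity)
  obtain ⟨N₂, h₂⟩ := exists_window ν z hz (show 0 < ε / M by positivity)
  obtain ⟨N₃, h₃⟩ := exists_window ρ z hz (show 0 < ε by positivity)
  set n := max N₁ (max N₂ N₃)
  replace h₁ := h₁ n (le_max_left _ _)
  replace h₂ := h₂ n ((le_max_left _ _).trans (le_max_right _ _))
  replace h₃ := h₃ n ((le_max_right _ _).trans (le_max_right _ _))
  obtain ⟨Z, hZ1, hZ⟩ := exists_eq_sum_fiber hχ z hz n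
  set W := window z hz n
  set h : X → F := (W : Set X).indicator (fun x => χ (z x)) with hh
  have hstep : ∀ τ : TightMeasure X L, τ.HasIntegral h
      (∑ ζ ∈ Z, ζ * algebraMap L F (τ.toFun (fiber hχ z hz n ζ))) := by
    intro τ
    rw [show h = _ from funext hZ]
    exact HasIntegral.sum Z fun ζ _ => HasIntegral.indicator τ _ ζ
  have happrox : ∀ (τ : TightMeasure X L) (η : ℝ), 0 ≤ η → τ.normOn Wᶜ ≤ η →
      ∀ x, ‖χ (z x) - h x‖ * τ.density x ≤ η := by
    intro τ η hη hτ x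
    by_cases hx : x ∈ W
    · rw [hh, Set.indicator_of_mem hx, sub_self, norm_zero, zero_mul]
      exact hη
    · rw [hh, Set.indicator_of_notMem hx, sub_zero, hχ.norm_eq_one, one_mul]
      exact (τ.density_le (A := Wᶜ) hx).trans hτ
  have hh1 : ∀ x, ‖h x‖ ≤ 1 := fun x =>
    (norm_indicator_le_norm_self _ _).trans (hχ.norm_eq_one _).le
  set I' := ∑ ζ ∈ Z, ζ * algebraMap L F (μ.toFun (fiber hχ z hz n ζ))
  set J' := ∑ ζ ∈ Z, ζ * algebraMap L F (ν.toFun (fiber hχ z hz n ζ))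
  set R := ∑ ζ ∈ Z, ζ * algebraMap L F (ρ.toFun (fiber hχ z hz n ζ))
  -- the inner integral `∫ h (y + x) μ(dy)`
  set G : X → F := fun x =>
    ∑ ζ ∈ Z, ζ * algebraMap L F (μ.toFun (translate (fiber hχ z hz n ζ) x))
  have hGR : ν.HasIntegral G R := HasIntegral.sum Z fun ζ _ => ((hρ _).map_algebraMap).const_mul ζ
  have hGx : ∀ x, μ.HasIntegral (fun y => h (y + x)) (G x) := by
    intro x
    have : (fun y => h (y + x)) = fun y => ∑ ζ ∈ Z,
        (translate (fiber hχ z hz n ζ) x : Set X).indicator (fun _ => ζ) y :=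
      funext fun y => hZ (y + x)
    rw [this]
    exact HasIntegral.sum Z fun ζ _ => HasIntegral.indicator μ _ ζ
  have hGW : ∀ x ∈ W, G x = I' * h x := by
    intro x hx
    refine (hGx x).unique ?_
    have : (fun y => h (y + x)) = fun y => h x * h y := by
      funext y
      rw [hh, Set.indicator_of_mem (show x ∈ (W : Set X) from hx)]
      by_cases hy : y ∈ W
      · rw [Set.indicator_of_mem (show y ∈ (W : Set X) from hy),
          Set.indicator_of_mem (show y + x ∈ (W : Set X) from (add_mem_window_iff hx).2 hy),
          map_add, χ.map_add_eq_mul, mul_comm]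
      · rw [Set.indicator_of_notMem (show y ∉ (W : Set X) from hy),
          Set.indicator_of_notMem (show y + x ∉ (W : Set X) from
            fun h => hy ((add_mem_window_iff hx).1 h)), mul_zero]
    rw [this, mul_comm]
    exact (hstep μ).const_mul (h x)
  have hGc : ∀ x, ‖G x‖ ≤ c := fun x => (hGx x).norm_le (by positivity) fun y =>
    (mul_le_mul (hh1 _) (hc y) (μ.density_nonneg y) zero_le_one).trans (one_mul c).le
  have hcM : c * (ε / M) ≤ ε := by
    rw [← mul_div_assoc, div_le_iff₀ (by positivity)]
    nlinarith
  have hdM : ε / M * d ≤ ε := by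
    rw [div_mul_eq_mul_div, div_le_iff₀ (by positivity)]
    nlinarith
  have hIc : ‖I'‖ ≤ c := (hstep μ).norm_le (by positivity) fun y =>
    (mul_le_mul (hh1 _) (hc y) (μ.density_nonneg y) zero_le_one).trans (one_mul c).le
  have hJd : ‖J‖ ≤ d := hJ.norm_le (by positivity) fun y =>
    (mul_le_mul (hχ.norm_eq_one _).le (hd y) (ν.density_nonneg y) zero_le_one).trans (one_mul d).le
  have e1 : ‖I - I'‖ ≤ ε / M :=
    hI.norm_sub_le (hstep μ) (by positivity) (happrox μ _ (by positivity) h₁)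
  have e2 : ‖J - J'‖ ≤ ε / M :=
    hJ.norm_sub_le (hstep ν) (by positivity) (happrox ν _ (by positivity) h₂)
  have e3 : ‖I' * J' - R‖ ≤ ε := by
    refine ((hstep ν).const_mul I').norm_sub_le hGR hε.le fun x => ?_
    by_cases hx : x ∈ W
    · rw [hGW x hx, sub_self, norm_zero, zero_mul]
      exact hε.le
    · rw [hh, Set.indicator_of_notMem (show x ∉ (W : Set X) from hx), mul_zero, zero_sub, norm_neg]
      exact (mul_le_mul (hGc x) ((ν.density_le (A := Wᶜ) hx).trans h₂) (ν.density_nonneg x)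
        (by positivity)).trans hcM
  refine ⟨h, R, hstep ρ, happrox ρ ε hε.le h₃, ?_⟩
  rw [show I * J - R = (I - I') * J + (I' * (J - J') + (I' * J' - R)) by ring]
  refine (IsUltrametricDist.norm_add_le_max _ _).trans (max_le ?_
    ((IsUltrametricDist.norm_add_le_max _ _).trans (max_le ?_ e3)))
  · rw [norm_mul]
    exact (mul_le_mul e1 hJd (norm_nonneg _) (by positivity)).trans hdM
  · rw [norm_mul]
    exact (mul_le_mul hIc e2 (norm_nonneg _) (by positivity)).trans hcM

end CharFun

/-! ### Uniqueness of a measure with a given characteristic functional -/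

section Agree

variable {F L : Type*} [NormedField F] [NormedField L] [NormedAlgebra L F]
  {X : Type*} [TopologicalSpace X]

/-- The measures `μ` and `ν` both integrate `f`, with the same integral. -/
def Agree (μ ν : TightMeasure X L) (f : X → F) : Prop :=
  ∃ I, μ.HasIntegral f I ∧ ν.HasIntegral f I

variable {μ ν : TightMeasure X L}

lemma Agree.const_mul {f : X → F} (h : Agree μ ν f) (a : F) : Agree μ ν fun x => a * f x := by
  obtain ⟨I, h1, h2⟩ := h
  exact ⟨_, h1.const_mul a, h2.const_mul a⟩

variable [IsUltrametricDist L] [IsUltrametricDist F]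

lemma Agree.sum {ι : Type*} (s : Finset ι) {f : ι → X → F} (h : ∀ i, Agree μ ν (f i)) :
    Agree μ ν fun x => ∑ i ∈ s, f i x := by
  choose I h1 h2 using h
  exact ⟨_, HasIntegral.sum s fun i _ => h1 i, HasIntegral.sum s fun i _ => h2 i⟩

lemma Agree.of_forall {f : X → F} {I J : F} (hI : μ.HasIntegral f I) (hJ : ν.HasIntegral f J)
    (h : ∀ ε > 0, ∃ g : X → F, Agree μ ν g ∧ (∀ x, ‖f x - g x‖ * μ.density x ≤ ε) ∧
      ∀ x, ‖f x - g x‖ * ν.density x ≤ ε) : Agree μ ν f := by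
  suffices hIJ : I = J from ⟨I, hI, hIJ ▸ hJ⟩
  refine sub_eq_zero.1 (norm_le_zero_iff.1 (le_of_forall_pos_le_add fun ε hε => ?_))
  obtain ⟨g, ⟨G, hμ, hν⟩, h1, h2⟩ := h ε hε
  rw [zero_add, ← sub_add_sub_cancel I G J]
  refine (IsUltrametricDist.norm_add_le_max _ _).trans (max_le ?_ ?_)
  · exact hI.norm_sub_le hμ hε.le h1
  · rw [norm_sub_rev]
    exact hJ.norm_sub_le hν hε.le h2

lemma Agree.toFun_eq {A : Clopens X}
    (h : Agree μ ν ((A : Set X).indicator fun _ => (1 : F))) : μ.toFun A = ν.toFun A := by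
  obtain ⟨I, h1, h2⟩ := h
  have e1 := h1.unique (HasIntegral.indicator μ A 1)
  have e2 := h2.unique (HasIntegral.indicator ν A 1)
  rw [one_mul] at e1 e2
  exact (algebraMap L F).injective (e1.symm.trans e2)

/-- Two measures that agree on `A` up to sets of arbitrarily small norm agree on `A`. -/
lemma toFun_eq_of_shrinking {ι : Type*} [Nonempty ι] {A : Clopens X} (C : ι → Clopens X)
    (hdir : ∀ i j, ∃ k, C k ≤ C i ⊓ C j) (hempty : ∀ x, ∃ i, x ∉ C i)
    (h : ∀ i, μ.toFun A - ν.toFun A = μ.toFun (C i) - ν.toFun (C i) ∨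
      μ.toFun A - ν.toFun A = ν.toFun (C i) - μ.toFun (C i)) : μ.toFun A = ν.toFun A := by
  refine sub_eq_zero.1 (norm_le_zero_iff.1 (le_of_forall_pos_le_add fun ε hε => ?_))
  obtain ⟨i, hi⟩ := μ.exists_normOn_le C hdir hempty hε
  obtain ⟨j, hj⟩ := ν.exists_normOn_le C hdir hempty hε
  obtain ⟨k, hk⟩ := hdir i j
  have h1 : ‖μ.toFun (C k)‖ ≤ ε := (μ.norm_le_normOn (hk.trans inf_le_left)).trans hi
  have h2 : ‖ν.toFun (C k)‖ ≤ ε := (ν.norm_le_normOn (hk.trans inf_le_right)).trans hj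
  have h3 : ‖μ.toFun (C k) - ν.toFun (C k)‖ ≤ ε := by
    rw [sub_eq_add_neg]
    exact (IsUltrametricDist.norm_add_le_max _ _).trans (max_le h1 (by rwa [norm_neg]))
  rw [zero_add]
  rcases h k with h | h
  · rwa [h]
  · rwa [h, norm_sub_rev]

end Agree

section Uniqueness

variable {K F L : Type*} [NontriviallyNormedField K] [NormedField F]
  [NormedField L] [NormedAlgebra L F] {X : Type*} [AddCommGroup X] [Module K X] [TopologicalSpace X]

/-- The common kernel of the characters `χ ∘ z` for `z` in a set of functionals. -/
def charKer (χ : AddChar K F) (T : Set (X →L[K] K)) : AddSubgroup X where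
  carrier := {x | ∀ z ∈ T, χ (z x) = 1}
  zero_mem' := fun z _ => by simp
  add_mem' := fun hx hy z hz => by
    rw [map_add, χ.map_add_eq_mul, hx z hz, hy z hz, one_mul]
  neg_mem' := fun hx z hz => by
    rw [map_neg, χ.map_neg_eq_inv, hx z hz, inv_one]

/-- A clopen set that is an intersection of cosets of kernels of characters from `D`. -/
def IsCosetInter (χ : AddChar K F) (D : Submodule K (X →L[K] K)) (A : Clopens X) : Prop :=
  ∃ T : Set ((X →L[K] K) × X), (∀ i ∈ T, i.1 ∈ D) ∧ ∀ x, x ∈ A ↔ ∀ i ∈ T, χ (i.1 (x - i.2)) = 1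

lemma isCosetInter_top {χ : AddChar K F} (D : Submodule K (X →L[K] K)) : IsCosetInter χ D (⊤ : Clopens X) :=
  ⟨∅, by simp, fun x => iff_of_true (Set.mem_univ x) (by simp)⟩

lemma IsCosetInter.inf {χ : AddChar K F} {D : Submodule K (X →L[K] K)} {A C : Clopens X}
    (hA : IsCosetInter χ D A) (hC : IsCosetInter χ D C) : IsCosetInter χ D (A ⊓ C) := by
  obtain ⟨T, hT, hAT⟩ := hA
  obtain ⟨T', hT', hCT⟩ := hC
  refine ⟨T ∪ T', fun i hi => hi.elim (hT i) (hT' i), fun x => ?_⟩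
  have : x ∈ A ⊓ C ↔ x ∈ A ∧ x ∈ C := Iff.rfl
  rw [this, hAT, hCT]
  simp only [Set.mem_union, or_imp, forall_and]

variable [NonarchimedeanAddGroup X] {p : ℕ} {χ : AddChar K F} {μ ν : TightMeasure X L}

/-- The coset through `a` of the kernel of the character `χ ∘ z`. -/
def charCoset (hχ : IsTame p χ) (i : (X →L[K] K) × X) : Clopens X :=
  ⟨{x | χ (i.1 (x - i.2)) = 1},
    (hχ.isLocallyConstant.comp_continuous (by fun_prop : Continuous fun x => i.1 (x - i.2))
      ).isClopen_fiber 1⟩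

lemma mem_charCoset {hχ : IsTame p χ} {i : (X →L[K] K) × X} {x : X} :
    x ∈ charCoset hχ i ↔ χ (i.1 (x - i.2)) = 1 := Iff.rfl

variable [IsUltrametricDist K] [IsUltrametricDist L] [IsUltrametricDist F]

lemma exists_hasIntegral_indicator_char [Fact p.Prime] [CompleteSpace F] (hχ : IsTame p χ)
    (μ : TightMeasure X L) (A : Clopens X) (w : X →L[K] K) :
    ∃ I, μ.HasIntegral ((A : Set X).indicator fun x => χ (w x)) I := by
  refine exists_hasIntegral (M := 1)
    (fun x => (norm_indicator_le_norm_self _ _).trans (hχ.norm_eq_one _).le) fun x ε hε => ?_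
  by_cases hx : x ∈ A
  · refine ⟨A ⊓ charCoset hχ (w, x), ⟨hx, by simp [charCoset]⟩, fun y hy => ?_⟩
    have : χ (w y) = χ (w x) := by
      rw [← sub_add_cancel y x, map_add, χ.map_add_eq_mul, mem_charCoset.1 hy.2, one_mul]
    rw [Set.indicator_of_mem (show y ∈ (A : Set X) from hy.1),
      Set.indicator_of_mem (show x ∈ (A : Set X) from hx), this, sub_self, norm_zero]
    exact hε.le
  · refine ⟨Aᶜ, hx, fun y hy => ?_⟩
    rw [Set.indicator_of_notMem (show y ∉ (A : Set X) from hy),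
      Set.indicator_of_notMem (show x ∉ (A : Set X) from hx), sub_self, norm_zero]
    exact hε.le

/-- The averages `p ^ (-m) ∑_{t < p ^ m} χ(t z(x - a))` are bounded by `1`, and on a window of `z`
they are equal, for large `m`, to the indicator of the coset `{x | χ(z(x - a)) = 1}`. Thus
agreement on the characters localizes to such cosets. -/
lemma agree_inf_charCoset [Fact p.Prime] [CompleteSpace F] (hpF : ‖(p : F)‖ = 1)
    (hχ : IsTame p χ) {D : Submodule K (X →L[K] K)} {A : Clopens X}
    (hA : ∀ w ∈ D, Agree μ ν ((A : Set X).indicator fun x => χ (w x)))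
    {i : (X →L[K] K) × X} (hi : i.1 ∈ D) :
    ∀ w ∈ D, Agree μ ν
      (((A ⊓ charCoset hχ i : Clopens X) : Set X).indicator fun x => χ (w x)) := by
  obtain ⟨z, a⟩ := i
  intro w hw
  obtain ⟨I, hI⟩ := exists_hasIntegral_indicator_char hχ μ (A ⊓ charCoset hχ (z, a)) w
  obtain ⟨J, hJ⟩ := exists_hasIntegral_indicator_char hχ ν (A ⊓ charCoset hχ (z, a)) w
  refine .of_forall hI hJ fun ε hε => ?_
  obtain ⟨N₁, h₁⟩ := exists_window μ z.toLinearMap.toAddMonoidHom z.continuous hε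
  obtain ⟨N₂, h₂⟩ := exists_window ν z.toLinearMap.toAddMonoidHom z.continuous hε
  set n := max N₁ N₂
  replace h₁ := h₁ n (le_max_left _ _)
  replace h₂ := h₂ n (le_max_right _ _)
  set W := window z.toLinearMap.toAddMonoidHom z.continuous n
  obtain ⟨m, hm⟩ := hχ.exists_pow (max (n + 1) ‖z a‖)
  set f : X → F := (A : Set X).indicator fun x => χ (w x) with hf
  set η : X → F := fun x => χ (z (x - a)) with hη
  have hpm : ‖((p ^ m : ℕ) : F)‖ = 1 := by rw [Nat.cast_pow, norm_pow, hpF, one_pow]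
  have hpm0 : ((p ^ m : ℕ) : F) ≠ 0 := norm_ne_zero_iff.1 (by rw [hpm]; exact one_ne_zero)
  set g : X → F := fun x =>
    ((p ^ m : ℕ) : F)⁻¹ * ((∑ t ∈ Finset.range (p ^ m), η x ^ t) * f x) with hg
  have hgA : Agree μ ν g := by
    have hsum : g = fun x => ((p ^ m : ℕ) : F)⁻¹ * ∑ t ∈ Finset.range (p ^ m),
        χ (-(t • z a)) * (A : Set X).indicator (fun x => χ ((w + t • z) x)) x := by
      funext x
      rw [hg]
      simp only [Finset.sum_mul]
      refine congrArg _ (Finset.sum_congr rfl fun t _ => ?_)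
      by_cases hx : x ∈ (A : Set X)
      · rw [hf, Set.indicator_of_mem hx, Set.indicator_of_mem hx, ← χ.map_nsmul_eq_pow,
          ← χ.map_add_eq_mul, ← χ.map_add_eq_mul, map_sub]
        congr 1
        simp only [add_apply, smul_apply, smul_sub]
        abel
      · rw [hf, Set.indicator_of_notMem hx, Set.indicator_of_notMem hx, mul_zero, mul_zero]
    rw [hsum]
    refine Agree.const_mul (Agree.sum _ fun t => Agree.const_mul (hA _ ?_) _) _
    exact D.add_mem hw (D.smul_of_tower_mem t hi)
  have hW : ∀ x ∈ W, ((A ⊓ charCoset hχ (z, a) : Clopens X) : Set X).indicator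
      (fun x => χ (w x)) x = g x := by
    intro x hx
    have hηm : η x ^ p ^ m = 1 := by
      refine hm _ ?_
      rw [map_sub, sub_eq_add_neg]
      refine (IsUltrametricDist.norm_add_le_max _ _).trans (max_le_max ?_ (norm_neg _).le)
      exact mem_window_iff.1 hx
    by_cases h1 : η x = 1
    · have : g x = f x := by
        simp only [hg, h1, one_pow, Finset.sum_const, Finset.card_range, nsmul_eq_mul, mul_one]
        rw [inv_mul_cancel_left₀ hpm0]
      rw [this, hf]
      by_cases hxA : x ∈ (A : Set X)
      · rw [Set.indicator_of_mem hxA, Set.indicator_of_mem]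
        exact ⟨hxA, h1⟩
      · rw [Set.indicator_of_notMem hxA, Set.indicator_of_notMem]
        exact fun h => hxA h.1
    · rw [Set.indicator_of_notMem fun h => h1 h.2]
      simp only [hg]
      rw [geom_sum_eq_zero hηm h1, zero_mul, mul_zero]
  have hg1 : ∀ x, ‖g x‖ ≤ 1 := by
    intro x
    simp only [hg]
    rw [norm_mul, norm_inv, hpm, inv_one, one_mul, norm_mul]
    exact mul_le_one₀ (norm_geom_sum_le (hχ.norm_eq_one _) _) (norm_nonneg _)
      ((norm_indicator_le_norm_self _ _).trans (hχ.norm_eq_one _).le)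
  have hclose : ∀ τ : TightMeasure X L, τ.normOn Wᶜ ≤ ε → ∀ x,
      ‖((A ⊓ charCoset hχ (z, a) : Clopens X) : Set X).indicator (fun x => χ (w x)) x - g x‖ *
        τ.density x ≤ ε := by
    intro τ hτ x
    by_cases hx : x ∈ W
    · rw [hW x hx, sub_self, norm_zero, zero_mul]
      exact hε.le
    · refine (mul_le_mul ?_ ((τ.density_le (A := Wᶜ) hx).trans hτ) (τ.density_nonneg x)
        zero_le_one).trans (one_mul ε).le
      rw [sub_eq_add_neg]
      exact (IsUltrametricDist.norm_add_le_max _ _).trans (max_le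
        ((norm_indicator_le_norm_self _ _).trans (hχ.norm_eq_one _).le)
        (by rw [norm_neg]; exact hg1 x))
  exact ⟨g, hgA, hclose μ h₁, hclose ν h₂⟩

lemma toFun_eq_of_isCosetInter [Fact p.Prime] [CompleteSpace F] (hpF : ‖(p : F)‖ = 1)
    (hχ : IsTame p χ) {D : Submodule K (X →L[K] K)}
    (h : ∀ w ∈ D, Agree μ ν fun x => χ (w x)) {A : Clopens X} (hA : IsCosetInter χ D A) :
    μ.toFun A = ν.toFun A := by
  classical
  obtain ⟨T, hT, hAT⟩ := hA
  have hfin : ∀ t : Finset T, ∀ w ∈ D, Agree μ ν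
      (((t.inf fun i => charCoset hχ i.1 : Clopens X) : Set X).indicator fun x => χ (w x)) := by
    intro t
    induction t using Finset.induction_on with
    | empty => simpa using h
    | insert i t _ ih =>
      rw [Finset.inf_insert, inf_comm]
      exact agree_inf_charCoset hpF hχ ih (hT i.1 i.2)
  have heq : ∀ t : Finset T, μ.toFun (t.inf fun i => charCoset hχ i.1)
      = ν.toFun (t.inf fun i => charCoset hχ i.1) := by
    intro t
    have := hfin t 0 D.zero_mem
    simp only [zero_apply, AddChar.map_zero_eq_one] at this
    exact this.toFun_eq
  have hle : ∀ t : Finset T, A ≤ t.inf fun i => charCoset hχ i.1 := fun t =>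
    Finset.le_inf fun i _ x hx => (hAT x).1 hx i.1 i.2
  refine toFun_eq_of_shrinking (fun t : Finset T => (t.inf fun i => charCoset hχ i.1) \ A)
    (fun t u => ⟨t ∪ u, ?_⟩) (fun x => ?_) (fun t => Or.inr ?_)
  · rw [Finset.inf_union]
    exact le_inf (sdiff_le_sdiff_right inf_le_left) (sdiff_le_sdiff_right inf_le_right)
  · by_cases hx : x ∈ A
    · exact ⟨∅, fun h => h.2 hx⟩
    · rw [hAT] at hx
      push Not at hx
      obtain ⟨i, hi, hne⟩ := hx
      refine ⟨{⟨i, hi⟩}, fun h => hne ?_⟩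
      have := h.1
      rw [Finset.inf_singleton] at this
      exact this
  · have e1 := μ.toFun_inf_add_sdiff (t.inf fun i => charCoset hχ i.1) A
    have e2 := ν.toFun_inf_add_sdiff (t.inf fun i => charCoset hχ i.1) A
    rw [inf_eq_right.2 (hle t)] at e1 e2
    linear_combination e1 - e2 + heq t

/-- Two measures with the same integrals of the characters `χ ∘ z`, `z ∈ D`, are equal, if kernels
of families of such characters form a neighbourhood base of zero. The cosets of these kernels are
stable under intersections, so agreement passes to their finite unions, and these exhaust every
clopen set. -/
theorem eq_of_agree_char [Fact p.Prime] [CompleteSpace F] (hpF : ‖(p : F)‖ = 1)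
    (hχ : IsTame p χ) {D : Submodule K (X →L[K] K)}
    (hD : ∀ U ∈ 𝓝 (0 : X), ∃ T ⊆ (D : Set (X →L[K] K)),
      (charKer χ T : Set X) ∈ 𝓝 0 ∧ (charKer χ T : Set X) ⊆ U)
    (h : ∀ w ∈ D, Agree μ ν fun x => χ (w x)) : μ = ν := by
  classical
  have hunion : ∀ (t : Finset (Clopens X)), (∀ A ∈ t, IsCosetInter χ D A) →
      ∀ C, IsCosetInter χ D C → μ.toFun (C ⊓ t.sup id) = ν.toFun (C ⊓ t.sup id) := by
    intro t
    induction t using Finset.induction_on with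
    | empty =>
      intro _ C _
      simp [toFun_bot]
    | insert A t _ ih =>
      intro ht C hC
      have ih := ih fun B hB => ht B (Finset.mem_insert_of_mem hB)
      have hA := ht A (Finset.mem_insert_self A t)
      -- inclusion and exclusion
      have key : ∀ τ : TightMeasure X L, τ.toFun (C ⊓ (A ⊔ t.sup id)) =
          τ.toFun (C ⊓ A) + (τ.toFun (C ⊓ t.sup id) - τ.toFun ((C ⊓ A) ⊓ t.sup id)) := by
        intro τ
        rw [← τ.toFun_inf_add_sdiff (C ⊓ (A ⊔ t.sup id)) A,
          ← τ.toFun_inf_add_sdiff (C ⊓ t.sup id) A]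
        have e1 : C ⊓ (A ⊔ t.sup id) ⊓ A = C ⊓ A := by
          rw [inf_assoc, inf_comm (A ⊔ _), inf_sup_self]
        have e2 : (C ⊓ (A ⊔ t.sup id)) \ A = (C ⊓ t.sup id) \ A := by
          rw [inf_sdiff_assoc, inf_sdiff_assoc, sup_sdiff_left_self]
        have e3 : C ⊓ t.sup id ⊓ A = C ⊓ A ⊓ t.sup id := inf_right_comm _ _ _
        rw [e1, e2, e3]
        ring
      rw [Finset.sup_insert, id_eq, key μ, key ν, ih C hC, ih _ (hC.inf hA),
        toFun_eq_of_isCosetInter hpF hχ h (hC.inf hA)]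
  have hbase : ∀ (A : Clopens X) (x : X), x ∈ A →
      ∃ V : Clopens X, IsCosetInter χ D V ∧ x ∈ V ∧ V ≤ A := by
    intro A x hx
    obtain ⟨T, hTD, hT, hTU⟩ := hD ((fun u => u + x) ⁻¹' (A : Set X))
      ((A.isOpen.preimage (by fun_prop)).mem_nhds (by simpa using hx))
    let U : OpenAddSubgroup X := ⟨charKer χ T, (charKer χ T).isOpen_of_mem_nhds hT⟩
    refine ⟨coset U x, ⟨(fun z => (z, x)) '' T, ?_, fun y => ?_⟩, self_mem_coset U x, fun y hy => ?_⟩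
    · rintro _ ⟨z, hz, rfl⟩
      exact hTD hz
    · rw [Set.forall_mem_image]
      exact Iff.rfl
    · have := hTU hy
      simpa using this
  ext A
  choose V hV hxV hVA using fun x : A => hbase A x.1 x.2
  refine toFun_eq_of_shrinking (fun t : Finset A => A \ t.sup V) (fun t u => ⟨t ∪ u, ?_⟩)
    (fun x => ?_) (fun t => Or.inl ?_)
  · rw [Finset.sup_union, sdiff_sup]
  · by_cases hx : x ∈ A
    · refine ⟨{⟨x, hx⟩}, fun h => h.2 ?_⟩
      rw [Finset.sup_singleton]
      exact hxV ⟨x, hx⟩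
    · exact ⟨∅, fun h => hx h.1⟩
  · have e : μ.toFun (t.sup V) = ν.toFun (t.sup V) := by
      have := hunion (t.image V) (by
        intro B hB
        obtain ⟨x, -, rfl⟩ := Finset.mem_image.1 hB
        exact hV x) ⊤ (isCosetInter_top D)
      rwa [top_inf_eq, Finset.sup_image, Function.id_comp] at this
    have hle : t.sup V ≤ A := Finset.sup_le fun x _ => hVA x
    have e1 := μ.toFun_inf_add_sdiff A (t.sup V)
    have e2 := ν.toFun_inf_add_sdiff A (t.sup V)
    rw [inf_eq_right.2 hle] at e1 e2
    linear_combination e2 - e1 + e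

end Uniqueness

/-! ### Projective limits of the spaces `c₀(α, K)` -/

section ProjectiveLimit

lemma norm_apply_le {K : Type*} [NontriviallyNormedField K] {β : Type*} [TopologicalSpace β]
    (f : C₀(β, K)) (k : β) : ‖f k‖ ≤ ‖f‖ :=
  f.toBCF.norm_coe_le_norm k

lemma norm_le_of_forall_apply_le {K : Type*} [NontriviallyNormedField K] {β : Type*}
    [TopologicalSpace β] {f : C₀(β, K)} {r : ℝ} (hr : 0 ≤ r) (h : ∀ k, ‖f k‖ ≤ r) : ‖f‖ ≤ r :=
  (f.toBCF.norm_le hr).2 h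

/-- The coordinate functional `x ↦ t x_k` on `c₀(β, K)`. -/
def coordFun {K : Type*} [NontriviallyNormedField K] {β : Type*} [TopologicalSpace β]
    (k : β) (t : K) : C₀(β, K) →L[K] K :=
  LinearMap.mkContinuous
    { toFun := fun f => t * f k
      map_add' := fun f g => by simp [mul_add]
      map_smul' := fun c f => by simp [mul_left_comm] } ‖t‖ fun f => by
    simpa using mul_le_mul_of_nonneg_left (norm_apply_le f k) (norm_nonneg t)

@[simp]
lemma coordFun_apply {K : Type*} [NontriviallyNormedField K] {β : Type*} [TopologicalSpace β]
    (k : β) (t : K) (f : C₀(β, K)) : coordFun k t f = t * f k := rfl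

variable {K : Type*} [NontriviallyNormedField K] {Υ : Type*} [Preorder Υ]
  {α : Υ → Type*} [∀ j, TopologicalSpace (α j)]

lemma exists_finset_norm_lt_subset (S : ProjSystems K α) {U : Set S.X} (hU : U ∈ 𝓝 0) :
    ∃ (J : Finset Υ) (r : ℝ), 0 < r ∧ {x : S.X | ∀ j ∈ J, ‖S.projX j x‖ < r} ⊆ U := by
  rw [nhds_subtype_eq_comap, Filter.mem_comap] at hU
  obtain ⟨V, hV, hVU⟩ := hU
  rw [Submodule.coe_zero, nhds_pi, Filter.mem_pi'] at hV
  obtain ⟨J, t, ht, hJ⟩ := hV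
  choose r hr hrt using fun j => Metric.mem_nhds_iff.1 (ht j)
  obtain ⟨r₀, hr₀, hle⟩ : ∃ r₀ > 0, ∀ j ∈ J, r₀ ≤ r j := by
    classical
    clear hJ
    induction J using Finset.induction_on with
    | empty => exact ⟨1, one_pos, by simp⟩
    | insert a J _ ih =>
      obtain ⟨r₀, h0, h⟩ := ih
      refine ⟨min r₀ (r a), lt_min h0 (hr a), fun j hj => ?_⟩
      rcases Finset.mem_insert.1 hj with rfl | hj
      · exact min_le_right _ _
      · exact (min_le_left _ _).trans (h j hj)
  refine ⟨J, r₀, hr₀, fun x hx => hVU (hJ fun j hj => hrt j ?_)⟩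
  rw [mem_ball_iff_norm, Pi.zero_apply, sub_zero]
  exact (hx j hj).trans_le (hle j hj)

variable [∀ j, DiscreteTopology (α j)]

lemma coordFun_comp_mem_domain (S : ProjSystems K α) (p s : ℕ) (q : ℝ) (j : Υ) (k : α j) (t : K) :
    (coordFun k t).comp (S.projX j) ∈ domain S p s q := by
  refine ⟨j, coordFun k t, (memℓp_zero ?_).of_exponent_ge (by norm_num), rfl⟩
  refine (Set.finite_singleton k).subset fun m hm => ?_
  by_contra hne
  exact hm (by simp [vFun, vCoord, basisVec, show k ≠ m from fun h => hne h.symm])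

/-- The kernels of the characters `χ ∘ z`, for families of multiples `z` of coordinates, form a
neighbourhood base of zero: `χ(t y) = 1` for all `|t| ≤ R` makes `y` small, because `χ` is
nontrivial, and holds for all small `y`, because `χ` is locally constant. -/
lemma exists_charKer_subset {F : Type*} [NormedField F] {p : ℕ} {χ : AddChar K F}
    (hχ : IsTame p χ) (hχ1 : χ ≠ 1) (S : ProjSystems K α) (s : ℕ) (q : ℝ)
    {U : Set S.X} (hU : U ∈ 𝓝 0) :
    ∃ T : Set (S.X →L[K] K), T ⊆ domain S p s q ∧
      (charKer (X := S.X) χ T : Set S.X) ∈ 𝓝 0 ∧ (charKer (X := S.X) χ T : Set S.X) ⊆ U := by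
  obtain ⟨J, r, hr, hJ⟩ := exists_finset_norm_lt_subset S hU
  obtain ⟨r₀, hr₀, hχr⟩ := hχ.exists_radius
  obtain ⟨a, ha⟩ : ∃ a, χ a ≠ 1 := by
    by_contra! h
    exact hχ1 (DFunLike.ext _ _ h)
  have ha0 : a ≠ 0 := by
    rintro rfl
    exact ha χ.map_zero_eq_one
  set R := 2 * ‖a‖ / r with hR
  have hR0 : 0 < R := by positivity
  refine ⟨{z | ∃ j ∈ J, ∃ (k : α j) (t : K), ‖t‖ ≤ R ∧ z = (coordFun k t).comp (S.projX j)},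
    ?_, ?_, fun x hx => hJ fun j hj => ?_⟩
  · rintro _ ⟨j, -, k, t, -, rfl⟩
    exact coordFun_comp_mem_domain S p s q j k t
  · have h : ∀ j ∈ J, ∀ᶠ x in 𝓝 (0 : S.X), ‖S.projX j x‖ < r₀ / R := fun j _ => by
      have h1 := ((S.projX j).continuous.norm).tendsto 0
      rw [map_zero, norm_zero] at h1
      exact h1.eventually (gt_mem_nhds (by positivity))
    filter_upwards [(Filter.eventually_all_finset J).2 h] with x hx
    rintro _ ⟨j, hj, k, t, ht, rfl⟩
    refine hχr _ ?_
    rw [ContinuousLinearMap.comp_apply, coordFun_apply, norm_mul]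
    calc ‖t‖ * ‖S.projX j x k‖ ≤ R * (r₀ / R) :=
          mul_le_mul ht ((norm_apply_le _ k).trans (hx j hj).le) (norm_nonneg _) hR0.le
      _ = r₀ := by field_simp
  · refine (norm_le_of_forall_apply_le (r := r / 2) (by positivity) fun k => ?_).trans_lt
      (half_lt_self hr)
    by_contra! hlt
    have hy : S.projX j x k ≠ 0 := norm_pos_iff.1 ((half_pos hr).trans hlt)
    -- the multiple `t = a / x_k` would be admissible
    refine ha ?_
    have h := hx _ ⟨j, hj, k, a / S.projX j x k, ?_, rfl⟩
    · rwa [ContinuousLinearMap.comp_apply, coordFun_apply, div_mul_cancel₀ _ hy] at h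
    · rw [norm_div, div_le_iff₀ (norm_pos_iff.2 hy), hR]
      calc ‖a‖ = 2 * ‖a‖ / r * (r / 2) := by field_simp
        _ ≤ 2 * ‖a‖ / r * ‖S.projX j x k‖ := by gcongr

lemma nonarchimedeanAddGroup_projLim {F : Type*} [NormedField F] {p : ℕ} {χ : AddChar K F}
    (hχ : IsTame p χ) (hχ1 : χ ≠ 1) (S : ProjSystems K α) : NonarchimedeanAddGroup S.X where
  is_nonarchimedean U hU := by
    obtain ⟨T, -, hT, hTU⟩ := exists_charKer_subset hχ hχ1 S 0 0 hU
    have hopen := AddSubgroup.isOpen_of_mem_nhds (charKer (X := S.X) χ T) hT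
    exact ⟨⟨charKer χ T, hopen⟩, hTU⟩

end ProjectiveLimit

/-! ### Sums of correlation forms and convolutions of `q`-Gaussian measures -/

lemma ProjSystems.IsTraceClass.add {K : Type*} [NontriviallyNormedField K] {Υ : Type*}
    [Preorder Υ] {α : Υ → Type*} [∀ j, TopologicalSpace (α j)] {S : ProjSystems K α}
    {B E : LinearMap.BilinForm ℝ (S.Y →L[ℝ] ℝ)} (hB : S.IsTraceClass B) (hE : S.IsTraceClass E) :
    S.IsTraceClass (B + E) := by
  intro j
  obtain ⟨T, hT, hTs⟩ := hB j
  obtain ⟨T', hT', hTs'⟩ := hE j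
  refine ⟨T + T', fun u w => ?_, ?_⟩
  · change B _ _ + E _ _ = inner ℝ (T u + T' u) w
    rw [hT, hT', inner_add_left]
  · simpa only [add_apply, inner_add_left] using hTs.add hTs'

lemma norm_natCast_eq (ℓ : ℕ) [Fact ℓ.Prime] (R : Type*) [NormedField R] [NormedAlgebra ℚ_[ℓ] R]
    (n : ℕ) : ‖(n : R)‖ = ‖(n : ℚ_[ℓ])‖ := by
  rw [← map_natCast (algebraMap ℚ_[ℓ] R), norm_algebraMap']

end QGauss

end

open QGauss in
theorem proposition6 {p s : ℕ} [Fact p.Prime] [Fact s.Prime] (hps : p ≠ s)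
    {K : Type*} [NontriviallyNormedField K] [IsUltrametricDist K] [NormedAlgebra ℚ_[p] K]
    [FiniteDimensional ℚ_[p] K]
    {Ks : Type*} [NormedField Ks] [IsUltrametricDist Ks] [CompleteSpace Ks] [NormedAlgebra ℚ_[s] Ks]
    {F : Type*} [NormedField F] [IsUltrametricDist F] [CompleteSpace F] [NormedAlgebra Ks F]
    (χ : AddChar K F) (hχ : Continuous χ) (hχ_one : χ ≠ 1) (hχ_root : ∀ x, IsOfFinOrder (χ x))
    (spow : Multiplicative ℝ →* F) (hspow : spow (Multiplicative.ofAdd 1) = (s : F))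
    {Υ : Type*} [Preorder Υ] {α : Υ → Type*}
    [∀ j, TopologicalSpace (α j)] [∀ j, DiscreteTopology (α j)]
    (S : ProjSystems K α) (q : ℝ) (hq : 0 < q)
    (B E : LinearMap.BilinForm ℝ (S.Y →L[ℝ] ℝ))
    (hB : S.IsTraceClass B) (hE : S.IsTraceClass E) (γ δ : S.X)
    (μ ν : TightMeasure S.X Ks)
    (hμ : IsQGaussian S p s χ spow q B γ μ) (hν : IsQGaussian S p s χ spow q E δ ν) :
    S.IsTraceClass (B + E) ∧
    ∃ ρ : TightMeasure S.X Ks,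
      IsConvolution μ ν ρ ∧ (∀ ρ', IsConvolution μ ν ρ' → ρ' = ρ) ∧
      IsQGaussian S p s χ spow q (B + E) (γ + δ) ρ ∧
      (∀ ρ' : TightMeasure S.X Ks, IsQGaussian S p s χ spow q (B + E) (γ + δ) ρ' → ρ' = ρ) := by
  have hpK : ‖(p : K)‖ < 1 := by
    rw [norm_natCast_eq p]
    exact Padic.norm_p_lt_one
  have hpF : ‖(p : F)‖ = 1 := by
    rw [← map_natCast (algebraMap Ks F), norm_algebraMap', norm_natCast_eq s]
    exact Padic.norm_natCast_eq_one_iff.2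
      ((Nat.coprime_primes Fact.out Fact.out).2 hps.symm)
  have hχt : IsTame p χ := isTame_of_continuous hpK hpF hχ hχ_root
  have : NonarchimedeanAddGroup S.X := nonarchimedeanAddGroup_projLim hχt hχ_one S
  obtain ⟨ρ, hρ⟩ := μ.exists_isConvolution ν
  have hρG : IsQGaussian S p s χ spow q (B + E) (γ + δ) ρ := by
    refine ⟨fun u w => ?_, fun u => ?_, hμ.linear, fun j zj hv => ?_⟩
    · exact congrArg₂ (· + ·) (hμ.symm u w) (hν.symm u w)
    · exact add_nonneg (hμ.nonneg u) (hν.nonneg u)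
    · have h := hρ.hasIntegral_char hχt (zj.comp (S.projX j)).toLinearMap.toAddMonoidHom
        (zj.comp (S.projX j)).continuous (hμ.charFun j zj hv) (hν.charFun j zj hv)
      rw [mul_mul_mul_comm, ← map_mul spow, ← ofAdd_add, ← χ.map_add_eq_mul, ← map_add,
        ← map_add] at h
      exact h
  refine ⟨hB.add hE, ρ, hρ, fun ρ' h => hρ.unique h, hρG, fun ρ' h => ?_⟩
  obtain ⟨W, hW⟩ := h.linear
  refine eq_of_agree_char hpF hχt (D := W) (fun U hU => ?_) fun w hw => ?_
  · rw [hW]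
    exact exists_charKer_subset hχt hχ_one S s q hU
  · have hw' : w ∈ domain S p s q := hW ▸ hw
    obtain ⟨j, zj, hv, rfl⟩ := hw'
    exact ⟨_, h.charFun j zj hv, hρG.charFun j zj hv⟩
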